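/- Let $L:\mathbb R^n\times\mathbb R^m\to\mathbb R$, write $z=(x,y)$, and let $F(z)=(\nabla_xL(x,y),-\nabla_yL(x,y))$, $A(z)=\nabla_{xx}L(x,y)$, $B(z)=\nabla_{xy}L(x,y)$, $C(z)=-\nabla_{yy}L(x,y)$, $E(z)=\tfrac12\|F(z)\|^2$ (Euclidean norm). For a step-size $s\ge 0$ consider the updates $z\mapsto z^+$ - GDA: $z^+=z-sF(z)$; - PPM: $z^+=z-sF(z^+)$; - EGM: $z^+=z-sF(z-sF(z))$; - JM: $z^+=z+s\,\nabla F(z)F(z)$. Fix $z^0$. For each of these algorithms and $\bar s>0$, let $S_{\bar s}$ be the convex hull of the set of all outputs $z^+$ of the algorithm with step-size $t\in[0,\bar s]$ from points $z$ with $\|F(z)\|\le\|F(z^0)\|$ (for PPM, all solutions of the implicit equation). Say that $F$ has *bounded derivatives up to order $k$* for the algorithm if for some $\bar s>0$ the norms $\|\nabla^jF\|$, $j=1,\dots,k$, are bounded on $S_{\bar s}$. For a function $\rho(\cdot)$, say that the algorithm *converges linearly with $\rho$* if there is $s^*>0$ such that for every $s\in(0,s^*]$ there is a sequence $(z^k)_{k\ge0}$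 starting at $z^0$ generated by the algorithm with step-size $s$, and every such sequence satisfies $E(z^k)\le\left(1-\tfrac{s\rho(s)}4\right)^kE(z^0)$ for all $k\ge0$ and, for some stationary point $z^*$ of $L$ (that is, $F(z^*)=0$) and some $\theta\in(0,1)$ and $c$, $\|z^k-z^*\|\le c\,\theta^k$ for all $k\ge0$. (i) Suppose $L$ is three times differentiable and for some $\rho>0$ $$F(z)^T\begin{bmatrix}A&0\\0&C\end{bmatrix}F(z)\ge\frac\rho2\|F(z)\|^2\quad\text{for all }z.$$ Then each of GDA, PPM and EGM for which $F$ has bounded derivatives up to order $2$ converges linearly with the constant $\rho$. (ii) Suppose $L$ is five times differentiable and there are $d>0$, $s_0>0$ and a function $\rho(\cdot)$ such that for all $s\in(0,s_0]$ one has $\rho(s)\ge ds$ and $$F(z)^T\begin{bmatrix}A-\frac s2A^2+\frac s2BB^T&0\\0&C-\frac s2C^2+\frac s2B^TB\end{bmatrix}F(z)\ge\frac{\rho(s)}2\|F(z)\|^2\quad\text{for all }z.$$ Then each of PPM and EGM for which $F$ has bounded derivatives up to order $4$ converges linearly with $\rho(\cdot)$. (iii) Suppose $L$ is five times differentiable and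 there are $d>0$, $s_0>0$ and a function $\rho(\cdot)$ such that for all $s\in(0,s_0]$ one has $\rho(s)\ge ds$ and $$F(z)^T\begin{bmatrix}A+\frac s2A^2-\frac s2BB^T&0\\0&C+\frac s2C^2-\frac s2B^TB\end{bmatrix}F(z)\ge\frac{\rho(s)}2\|F(z)\|^2\quad\text{for all }z.$$ If $F$ has bounded derivatives up to order $4$ for GDA, then GDA converges linearly with $\rho(\cdot)$. (iv) Suppose $L$ is four times differentiable and for some $\rho>0$ $$F(z)^T\begin{bmatrix}BB^T-A^2&0\\0&B^TB-C^2\end{bmatrix}F(z)\ge\frac\rho2\|F(z)\|^2\quad\text{for all }z.$$ If $F$ has bounded derivatives up to order $3$ for JM, then JM converges linearly with the constant $\rho$. -/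

import Mathlib

noncomputable section

namespace Minimax

/-- The space of pairs `z = (x, y)` with `x ∈ ℝⁿ` (left coordinates), `y ∈ ℝᵐ` (right coordinates),
with the Euclidean norm. -/
abbrev Pt (n m : ℕ) : Type := EuclideanSpace ℝ (Fin n ⊕ Fin m)

/-- The `i`-th standard basis vector. -/
def basisVec {n m : ℕ} (i : Fin n ⊕ Fin m) : Pt n m := EuclideanSpace.single i (1 : ℝ)

/-- `f` is `k` times (Fréchet) differentiable; continuity of the `k`-th derivative is not required. -/
def TimesDifferentiable {n m : ℕ} (k : ℕ) (f : Pt n m → ℝ) : Prop :=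
  ∀ j : ℕ, j < k → Differentiable ℝ (iteratedFDeriv ℝ j f)

/-- `F(z) = (∇ₓ L(x,y), -∇_y L(x,y))`. -/
def field {n m : ℕ} (L : Pt n m → ℝ) (z : Pt n m) : Pt n m :=
  WithLp.toLp 2 (Sum.elim
    (fun i : Fin n => fderiv ℝ L z (basisVec (Sum.inl i)))
    (fun j : Fin m => -(fderiv ℝ L z (basisVec (Sum.inr j)))))

/-- The Hessian matrix of `L` at `z`. -/
def hessian {n m : ℕ} (L : Pt n m → ℝ) (z : Pt n m) :
    Matrix (Fin n ⊕ Fin m) (Fin n ⊕ Fin m) ℝ :=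
  Matrix.of fun i j => fderiv ℝ (fderiv ℝ L) z (basisVec i) (basisVec j)

/-- `A(z) = ∇ₓₓ L`. -/
def blockA {n m : ℕ} (L : Pt n m → ℝ) (z : Pt n m) : Matrix (Fin n) (Fin n) ℝ :=
  (hessian L z).toBlocks₁₁

/-- `B(z) = ∇ₓ_y L`. -/
def blockB {n m : ℕ} (L : Pt n m → ℝ) (z : Pt n m) : Matrix (Fin n) (Fin m) ℝ :=
  (hessian L z).toBlocks₁₂

/-- `C(z) = -∇_yy L`. -/
def blockC {n m : ℕ} (L : Pt n m → ℝ) (z : Pt n m) : Matrix (Fin m) (Fin m) ℝ :=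
  -(hessian L z).toBlocks₂₂

/-- `vᵀ [M 0; 0 N] v`. -/
def blockQuad {n m : ℕ} (M : Matrix (Fin n) (Fin n) ℝ) (N : Matrix (Fin m) (Fin m) ℝ)
    (v : Pt n m) : ℝ :=
  v.ofLp ⬝ᵥ (Matrix.mulVec (Matrix.fromBlocks M 0 0 N) v.ofLp)

/-- The `O(1)`-linear-convergence condition of GDA, PPM and EGM with constant `ρ`. -/
def O1Condition {n m : ℕ} (L : Pt n m → ℝ) (ρ : ℝ) : Prop :=
  ∀ z : Pt n m,
    ρ / 2 * ‖field L z‖ ^ 2 ≤ blockQuad (blockA L z) (blockC L z) (field L z)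

/-- The `O(s)`-linear-convergence condition of PPM and EGM at step-size `s` with constant `r`. -/
def OsConditionPPM {n m : ℕ} (L : Pt n m → ℝ) (s r : ℝ) : Prop :=
  ∀ z : Pt n m,
    r / 2 * ‖field L z‖ ^ 2 ≤ blockQuad
      (blockA L z - (s / 2) • (blockA L z * blockA L z)
        + (s / 2) • (blockB L z * (blockB L z).transpose))
      (blockC L z - (s / 2) • (blockC L z * blockC L z)
        + (s / 2) • ((blockB L z).transpose * blockB L z))
      (field L z)

/-- The `O(s)`-linear-convergence condition of GDA at step-size `s` with constant `r`. -/
def OsConditionGDA {n m : ℕ} (L : Pt n m → ℝ) (s r : ℝ) : Prop :=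
  ∀ z : Pt n m,
    r / 2 * ‖field L z‖ ^ 2 ≤ blockQuad
      (blockA L z + (s / 2) • (blockA L z * blockA L z)
        - (s / 2) • (blockB L z * (blockB L z).transpose))
      (blockC L z + (s / 2) • (blockC L z * blockC L z)
        - (s / 2) • ((blockB L z).transpose * blockB L z))
      (field L z)

/-- The `O(1)`-linear-convergence condition of JM with constant `ρ`. -/
def O1ConditionJM {n m : ℕ} (L : Pt n m → ℝ) (ρ : ℝ) : Prop :=
  ∀ z : Pt n m,
    ρ / 2 * ‖field L z‖ ^ 2 ≤ blockQuad
      (blockB L z * (blockB L z).transpose - blockA L z * blockA L z)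
      ((blockB L z).transpose * blockB L z - blockC L z * blockC L z)
      (field L z)

/-- An iterate update: `step s z w` says that `w` is an output from `z` with step-size `s`.
A relation is used because the proximal point update is implicit. -/
abbrev Update (n m : ℕ) : Type := ℝ → Pt n m → Pt n m → Prop

/-- Gradient descent ascent: `z⁺ = z - s F(z)`. -/
def gda {n m : ℕ} (L : Pt n m → ℝ) : Update n m :=
  fun s z w => w = z - s • field L z

/-- Proximal point method: `z⁺ = z - s F(z⁺)`. -/
def ppm {n m : ℕ} (L : Pt n m → ℝ) : Update n m :=
  fun s z w => w = z - s • field L w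

/-- Extra-gradient method: `z⁺ = z - s F(z - s F(z))`. -/
def egm {n m : ℕ} (L : Pt n m → ℝ) : Update n m :=
  fun s z w => w = z - s • field L (z - s • field L z)

/-- Jacobian method: `z⁺ = z + s ∇F(z) F(z)`. -/
def jm {n m : ℕ} (L : Pt n m → ℝ) : Update n m :=
  fun s z w => w = z + s • fderiv ℝ (field L) z (field L z)

/-- `S = Conv {g(z,t) | 0 ≤ t ≤ s, ‖F(z)‖ ≤ ‖F(z⁰)‖}`. -/
def levelHull {n m : ℕ} (L : Pt n m → ℝ) (step : Update n m) (z0 : Pt n m) (s : ℝ) :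
    Set (Pt n m) :=
  convexHull ℝ {w | ∃ z t, ‖field L z‖ ≤ ‖field L z0‖ ∧ 0 ≤ t ∧ t ≤ s ∧ step t z w}

/-- For some positive `s`, the derivatives of `F` of orders `1, …, k` are bounded on `S`. -/
def BoundedOnHull {n m : ℕ} (L : Pt n m → ℝ) (step : Update n m) (z0 : Pt n m) (k : ℕ) : Prop :=
  ∃ s : ℝ, 0 < s ∧ ∀ j : ℕ, 1 ≤ j → j ≤ k →
    ∃ M : ℝ, ∀ z ∈ levelHull L step z0 s, ‖iteratedFDeriv ℝ j (field L) z‖ ≤ M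

/-- The energy `E(z) = ½ ‖F(z)‖²`. -/
def energy {n m : ℕ} (L : Pt n m → ℝ) (z : Pt n m) : ℝ := 1 / 2 * ‖field L z‖ ^ 2

/-- `u` is a run of the algorithm with step-size `s` from `z0`. -/
def IsRun {n m : ℕ} (step : Update n m) (s : ℝ) (z0 : Pt n m) (u : ℕ → Pt n m) : Prop :=
  u 0 = z0 ∧ ∀ k : ℕ, step s (u k) (u (k + 1))

/-- `u` converges linearly to a stationary point of `L`, and the energy decays with factor `q`. -/
def ConvergesLinearly {n m : ℕ} (L : Pt n m → ℝ) (u : ℕ → Pt n m) (q : ℝ) : Prop :=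
  (∀ k : ℕ, energy L (u k) ≤ q ^ k * energy L (u 0)) ∧
  ∃ zs : Pt n m, field L zs = 0 ∧
    ∃ θ C : ℝ, 0 < θ ∧ θ < 1 ∧ ∀ k : ℕ, ‖u k - zs‖ ≤ C * θ ^ k

/-- For all sufficiently small step-sizes the algorithm can be run from `z0`, and every run
converges linearly to a stationary point, with energy factor `1 - s ρ(s) / 4`. -/
def LinearForSmallSteps {n m : ℕ} (L : Pt n m → ℝ) (step : Update n m) (z0 : Pt n m)
    (ρ : ℝ → ℝ) : Prop :=
  ∃ sstar : ℝ, 0 < sstar ∧ ∀ s : ℝ, 0 < s → s ≤ sstar →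
    (∃ u, IsRun step s z0 u) ∧
    ∀ u, IsRun step s z0 u → ConvergesLinearly L u (1 - s * ρ s / 4)

end Minimax

end

/-!
Write `F` for the saddle field and `J` for its derivative. Up to `o(s²)`, a step of gradient descent
ascent, of the extra-gradient method or of the proximal point method is the time-`s` flow of the
modified field `W = -F + σ (s / 2) J F`, with `σ = -1` for the first and `σ = 1` for the others.
Along `W` the energy changes at the rate `-⟪F, J F⟫ + σ (s / 2) ⟪F, J (J F)⟫`. Since
`J = [A, B; -Bᵀ, C]` with `A` and `C` symmetric, both `J` and `J²` are block diagonal up to a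
skew-symmetric matrix, so this rate is the quadratic form of the hypotheses
(`inner_fderiv_field`, `inner_fderiv_field_sq`). For the Jacobian method, `W = J F`.

Instead of solving the differential equation, the energy is followed along an explicit quadratic
curve, which is an approximate integral curve of `W` (`NearlyAffine.normSq_le_of_curve`,
`NearlyAffine.normSq_step_le`, `NearlyAffine.normSq_jm_le`). All errors are measured by the
oscillation `ε` of `J` on a ball of radius `O(s ‖F z‖)` about the current point `z`; the decay under
the second-order conditions is at least of order `s²` and beats an error of order `ε s²`.

The curve, and the intermediate point of the extra-gradient method, can leave the set on which
derivatives of `F` are bounded. This is harmless (`eventually_nearlyAffine`): after `O(1 / s)`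
steps the energy has dropped by a factor `1 - O(s)`, and the small balls around all later points
lie in the initial sublevel set, while the earlier points stay in a compact ball about `z0` that is
independent of `s`, where `J` is uniformly continuous.

For the proximal point method, the derivative bound on the hull shows that each solution of the
implicit equation is within `2 s ‖F z‖` of `z` (`norm_ppm_le`), and solutions exist by continuation
in the step-size (`exists_proximal_point`). The distances between consecutive points of a run are
summable like a geometric series, so runs converge, and their limits are zeros of `F`
(`eventually_run_converges`).
-/

namespace Minimax

open Metric Set Filter Topology
open scoped RealInnerProductSpace

/-! ### Energy decay along approximate integral curves -/

section Local

variable {E : Type*} [NormedAddCommGroup E] [InnerProductSpace ℝ E]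

/-- `F` is differentiable with `‖DF(z)‖ ≤ M`, and on the closed ball of radius `R` about `z` the
derivative differs from `DF(z)` by at most `ε ≤ 1`, so that `F` is affine there up to a relative
error `ε`. -/
structure NearlyAffine (F : E → E) (z : E) (R M ε : ℝ) : Prop where
  differentiable : Differentiable ℝ F
  norm_fderiv_le : ‖fderiv ℝ F z‖ ≤ M
  le_one : ε ≤ 1
  osc_le : ∀ a ∈ closedBall z R, ‖fderiv ℝ F a - fderiv ℝ F z‖ ≤ ε

namespace NearlyAffine

variable {F : E → E} {z : E} {R M ε : ℝ}

lemma nonneg (h : NearlyAffine F z R M ε) : 0 ≤ M := (norm_nonneg _).trans h.norm_fderiv_le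

lemma norm_fderiv_le_add_one (h : NearlyAffine F z R M ε) {a : E} (ha : a ∈ closedBall z R) :
    ‖fderiv ℝ F a‖ ≤ M + 1 := by
  have h1 := norm_le_norm_add_norm_sub' (fderiv ℝ F a) (fderiv ℝ F z)
  linarith [h.osc_le a ha, h.norm_fderiv_le, h.le_one]

lemma norm_taylor_le (h : NearlyAffine F z R M ε) {a : E} (ha : a ∈ closedBall z R) :
    ‖F a - F z - fderiv ℝ F z (a - z)‖ ≤ ε * ‖a - z‖ := by
  have hz : z ∈ closedBall z R := mem_closedBall_self (dist_nonneg.trans (mem_closedBall.1 ha))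
  exact (convex_closedBall z R).norm_image_sub_le_of_norm_hasFDerivWithin_le'
    (fun x _ => (h.differentiable x).hasFDerivAt.hasFDerivWithinAt) h.osc_le hz ha

lemma norm_image_sub_le (h : NearlyAffine F z R M ε) {a b : E} (ha : a ∈ closedBall z R)
    (hb : b ∈ closedBall z R) : ‖F b - F a‖ ≤ (M + 1) * ‖b - a‖ :=
  (convex_closedBall z R).norm_image_sub_le_of_norm_hasFDerivWithin_le
    (fun x _ => (h.differentiable x).hasFDerivAt.hasFDerivWithinAt)
    (fun _ hx => h.norm_fderiv_le_add_one hx) ha hb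

lemma norm_sub_center_le (h : NearlyAffine F z R M ε) {a : E} (ha : a ∈ closedBall z R) :
    ‖F a - F z‖ ≤ (M + 1) * ‖a - z‖ :=
  h.norm_image_sub_le (mem_closedBall_self (dist_nonneg.trans (mem_closedBall.1 ha))) ha

lemma norm_apply_sub_le (h : NearlyAffine F z R M ε) {a : E} (ha : a ∈ closedBall z R) :
    ‖fderiv ℝ F z (F z) - fderiv ℝ F a (F a)‖ ≤ ε * ‖F z‖ + (M + 1) ^ 2 * ‖a - z‖ := by
  have e : fderiv ℝ F z (F z) - fderiv ℝ F a (F a)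
      = -((fderiv ℝ F a - fderiv ℝ F z) (F z)) - fderiv ℝ F a (F a - F z) := by
    simp only [sub_apply, map_sub]; abel
  rw [e]
  refine (norm_sub_le _ _).trans (add_le_add ?_ ?_)
  · rw [norm_neg]
    exact (ContinuousLinearMap.le_opNorm _ _).trans
      (mul_le_mul_of_nonneg_right (h.osc_le a ha) (norm_nonneg _))
  · calc _ ≤ ‖fderiv ℝ F a‖ * ‖F a - F z‖ := ContinuousLinearMap.le_opNorm _ _
      _ ≤ (M + 1) * ((M + 1) * ‖a - z‖) :=
        mul_le_mul (h.norm_fderiv_le_add_one ha) (h.norm_sub_center_le ha) (norm_nonneg _)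
          (by linarith [h.nonneg])
      _ = _ := by ring

/-- If `c` is an integral curve of `W` up to a velocity error `η ‖F z‖`, and `‖F‖ ^ 2` decreases
along `W` at rate at least `ρ`, then `‖F‖ ^ 2` decreases along `c` at half that rate, up to an
error proportional to `η`. The radius is so small that `‖F‖` changes by at most a quarter on the
ball; this is what the factor one half pays for. -/
lemma normSq_le_of_curve (h : NearlyAffine F z R M ε) {s ρ η : ℝ} (hs : 0 ≤ s) (hρ : 0 ≤ ρ)
    (hR : 4 * ((M + 1) * R) ≤ ‖F z‖) {c c' : ℝ → E} {W : E → E}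
    (hV : ∀ p ∈ closedBall z R, ρ / 2 * ‖F p‖ ^ 2 ≤ -⟪F p, fderiv ℝ F p (W p)⟫)
    (hc : ∀ t, HasDerivAt c (c' t) t) (hc0 : c 0 = z)
    (hball : ∀ t ∈ Icc 0 s, c t ∈ closedBall z R)
    (herr : ∀ t ∈ Icc 0 s, ‖c' t - W (c t)‖ ≤ η * ‖F z‖) :
    ‖F (c s)‖ ^ 2 ≤ (1 - s * ρ / 2 + 4 * (M + 1) * η * s) * ‖F z‖ ^ 2 := by
  set N := ‖F z‖ with hN
  have hM := h.nonneg
  have hderiv : ∀ t, HasDerivAt (fun t => ‖F (c t)‖ ^ 2)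
      (2 * ⟪F (c t), fderiv ℝ F (c t) (c' t)⟫) t := fun t =>
    ((h.differentiable (c t)).hasFDerivAt.comp_hasDerivAt t (hc t)).norm_sq
  have hbound : ∀ t ∈ Icc 0 s, 2 * ⟪F (c t), fderiv ℝ F (c t) (c' t)⟫
      ≤ (4 * (M + 1) * η - ρ / 2) * N ^ 2 := by
    intro t ht
    have hp := hball t ht
    have h1 := h.norm_sub_center_le hp
    have h2 : (M + 1) * ‖c t - z‖ ≤ (M + 1) * R :=
      mul_le_mul_of_nonneg_left (mem_closedBall_iff_norm.1 hp) (by linarith)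
    have h3 := abs_le.1 ((abs_norm_sub_norm_le (F (c t)) (F z)).trans (h1.trans h2))
    have hlow : N ^ 2 ≤ 2 * ‖F (c t)‖ ^ 2 := by
      have : 3 / 4 * N ≤ ‖F (c t)‖ := by linarith [h3.1]
      nlinarith [norm_nonneg (F z)]
    have hup : ‖F (c t)‖ ≤ 2 * N := by linarith [h3.2, norm_nonneg (F z)]
    have e : c' t = W (c t) + (c' t - W (c t)) := by abel
    have h4 : ⟪F (c t), fderiv ℝ F (c t) (c' t - W (c t))⟫ ≤ 2 * N * ((M + 1) * (η * N)) := by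
      refine (real_inner_le_norm _ _).trans (mul_le_mul hup ?_ (norm_nonneg _) (by positivity))
      exact (ContinuousLinearMap.le_opNorm _ _).trans
        (mul_le_mul (h.norm_fderiv_le_add_one hp) (herr t ht) (norm_nonneg _) (by linarith))
    rw [e, map_add, inner_add_right]
    nlinarith [hV _ hp]
  have := (convex_Icc (0 : ℝ) s).image_sub_le_mul_sub_of_deriv_le
    (f := fun t => ‖F (c t)‖ ^ 2) (fun t _ => (hderiv t).continuousAt.continuousWithinAt)
    (fun t _ => (hderiv t).differentiableAt.differentiableWithinAt)
    (C := (4 * (M + 1) * η - ρ / 2) * N ^ 2)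
    (fun t ht => by rw [(hderiv t).deriv]; exact hbound t (interior_subset ht))
    0 (left_mem_Icc.2 hs) s (right_mem_Icc.2 hs) hs
  simp only [hc0] at this
  rw [← hN] at this
  linarith

/-- Let `w` agree with `z - s F + (1 + σ) / 2 s² DF F` up to `O(s² ε)`. It is then the time-`s`
point of an approximate integral curve of the modified field `-F + σ (s / 2) DF F`, and the
hypothesis `hcond` says that `‖F‖ ^ 2` decreases along that field at rate `ρ`. The error is
`O(s² ε)` rather than `O(s²)`, so that it can be absorbed by a gain of order `s²`. -/
lemma normSq_step_le {s : ℝ} (h : NearlyAffine F z (2 * s * ‖F z‖) M ε) (hs : 0 ≤ s)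
    (hsε : 8 * (s * (M + 1) ^ 2) ≤ ε) {σ ρ : ℝ} (hσ : |σ| ≤ 1) (hρ : 0 ≤ ρ)
    (hcond : ∀ p ∈ closedBall z (2 * s * ‖F z‖), ρ / 2 * ‖F p‖ ^ 2 ≤
      ⟪F p, fderiv ℝ F p (F p)⟫ - σ * (s / 2) * ⟪F p, fderiv ℝ F p (fderiv ℝ F p (F p))⟫)
    {w : E} (hw : w ∈ closedBall z (2 * s * ‖F z‖))
    (hwc : ‖w - (z - s • F z + ((1 + σ) / 2 * s ^ 2) • fderiv ℝ F z (F z))‖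
      ≤ 4 * s ^ 2 * ε * ‖F z‖) :
    ‖F w‖ ^ 2 ≤ (1 - s * ρ / 2 + 36 * (M + 1) * ε * s ^ 2) * ‖F z‖ ^ 2 := by
  have hM := h.nonneg
  have hε1 := h.le_one
  obtain ⟨hσ1, hσ2⟩ := abs_le.1 hσ
  have hN := norm_nonneg (F z)
  have hJ : ‖fderiv ℝ F z (F z)‖ ≤ M * ‖F z‖ :=
    (ContinuousLinearMap.le_opNorm _ _).trans (mul_le_mul_of_nonneg_right h.norm_fderiv_le hN)
  have hsM : s * (M + 1) ≤ 1 / 8 := by nlinarith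
  have hsM' : s * M ≤ 1 := by nlinarith
  have hε0 : 0 ≤ ε := le_trans (by positivity) hsε
  set N := ‖F z‖ with hNdef
  set G := fderiv ℝ F z (F z) with hG
  -- The quadratic curve from `z` whose velocity at time `t` is `-F(z) + (σ s / 2 + t) DF(z) F(z)`,
  -- which is the modified field at `c t` up to `O(s ε)`.
  set c : ℝ → E := fun t => z + (t • (-F z + (σ * (s / 2)) • G) + (t ^ 2) • ((1 / 2 : ℝ) • G))
    with hcdef
  set c' : ℝ → E := fun t => (-F z + (σ * (s / 2)) • G) + (2 * t) • ((1 / 2 : ℝ) • G) with hc'def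
  have hc : ∀ t, HasDerivAt c (c' t) t := by
    intro t
    have h1 := (hasDerivAt_id t).smul_const (-F z + (σ * (s / 2)) • G)
    have h2 := ((hasDerivAt_id t).pow 2).smul_const ((1 / 2 : ℝ) • G)
    have := (h1.add h2).const_add z
    simpa [hcdef, hc'def] using this
  have hcz : ∀ t, c t - z = -(t • F z) + (t * (σ * (s / 2)) + t ^ 2 / 2) • G := by
    intro t; simp only [hcdef]; module
  have hcoef : ∀ t ∈ Icc 0 s, |t * (σ * (s / 2)) + t ^ 2 / 2| ≤ s ^ 2 := by
    rintro t ⟨ht0, hts⟩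
    have h1 : t * s ≤ s ^ 2 := by nlinarith
    have h2 : t ^ 2 ≤ s ^ 2 := by nlinarith
    have h3 : 0 ≤ t * s := by positivity
    rw [abs_le]; constructor <;> nlinarith
  have hcoefG : ∀ t ∈ Icc 0 s, ‖(t * (σ * (s / 2)) + t ^ 2 / 2) • G‖ ≤ s ^ 2 * (M * N) := by
    intro t ht
    rw [norm_smul, Real.norm_eq_abs]
    exact mul_le_mul (hcoef t ht) hJ (norm_nonneg _) (by positivity)
  have hball' : ∀ t ∈ Icc 0 s, ‖c t - z‖ ≤ 2 * s * N := by
    intro t ht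
    rw [hcz]
    refine (norm_add_le _ _).trans ?_
    have h1 : ‖-(t • F z)‖ ≤ s * N := by
      rw [norm_neg, norm_smul, Real.norm_of_nonneg ht.1]
      exact mul_le_mul_of_nonneg_right ht.2 hN
    have h2 : s ^ 2 * (M * N) ≤ s * N := by
      have := mul_le_mul_of_nonneg_right hsM' (mul_nonneg hs hN)
      nlinarith
    linarith [hcoefG t ht]
  have hball : ∀ t ∈ Icc 0 s, c t ∈ closedBall z (2 * s * N) := fun t ht =>
    mem_closedBall_iff_norm.2 (hball' t ht)
  have herr : ∀ t ∈ Icc 0 s,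
      ‖c' t - (-F (c t) + (σ * (s / 2)) • fderiv ℝ F (c t) (F (c t)))‖ ≤ (5 * s * ε) * N := by
    intro t ht
    have e : c' t - (-F (c t) + (σ * (s / 2)) • fderiv ℝ F (c t) (F (c t)))
        = (F (c t) - F z - fderiv ℝ F z (c t - z))
          + fderiv ℝ F z ((t * (σ * (s / 2)) + t ^ 2 / 2) • G)
          + (σ * (s / 2)) • (G - fderiv ℝ F (c t) (F (c t))) := by
      rw [hcz, map_add, map_neg, map_smul, ← hG]
      simp only [hc'def]
      module
    have h1 : ‖F (c t) - F z - fderiv ℝ F z (c t - z)‖ ≤ ε * (2 * s * N) :=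
      (h.norm_taylor_le (hball t ht)).trans (mul_le_mul_of_nonneg_left (hball' t ht) hε0)
    have h2 : ‖fderiv ℝ F z ((t * (σ * (s / 2)) + t ^ 2 / 2) • G)‖ ≤ M * (s ^ 2 * (M * N)) :=
      (ContinuousLinearMap.le_opNorm _ _).trans
        (mul_le_mul h.norm_fderiv_le (hcoefG t ht) (norm_nonneg _) hM)
    have h3 : ‖G - fderiv ℝ F (c t) (F (c t))‖ ≤ ε * N + (M + 1) ^ 2 * (2 * s * N) :=
      (h.norm_apply_sub_le (hball t ht)).trans (by gcongr; exact hball' t ht)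
    have h4 : ‖(σ * (s / 2)) • (G - fderiv ℝ F (c t) (F (c t)))‖
        ≤ s / 2 * (ε * N + (M + 1) ^ 2 * (2 * s * N)) := by
      rw [norm_smul, Real.norm_eq_abs, abs_mul, abs_of_nonneg (by linarith : 0 ≤ s / 2)]
      refine mul_le_mul ?_ h3 (norm_nonneg _) (by linarith)
      nlinarith
    rw [e]
    refine (norm_add₃_le).trans ((add_le_add_three h1 h2 h4).trans ?_)
    have h5 : 8 * (s * (M + 1) ^ 2) * (s * N) ≤ ε * (s * N) :=
      mul_le_mul_of_nonneg_right hsε (mul_nonneg hs hN)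
    have h6 : M ^ 2 * (s * s * N) ≤ (M + 1) ^ 2 * (s * s * N) :=
      mul_le_mul_of_nonneg_right (by nlinarith) (by positivity)
    have h7 : 0 ≤ (M + 1) ^ 2 * (s * s * N) := by positivity
    have h8 : 0 ≤ ε * (s * N) := by positivity
    nlinarith
  have hR : 4 * ((M + 1) * (2 * s * N)) ≤ ‖F z‖ := by
    have := mul_le_mul_of_nonneg_right hsM hN
    rw [← hNdef]; nlinarith
  have hmain := h.normSq_le_of_curve hs hρ hR
    (W := fun p => -F p + (σ * (s / 2)) • fderiv ℝ F p (F p))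
    (fun p hp => by
      have := hcond p hp
      simp only [map_add, map_neg, map_smul, inner_add_right, inner_neg_right, inner_smul_right]
      linarith) hc (by simp [hcdef]) hball herr
  have hcs : c s = z - s • F z + ((1 + σ) / 2 * s ^ 2) • G := by
    simp only [hcdef]; module
  rw [← hcs] at hwc
  have hs' : s ∈ Icc 0 s := right_mem_Icc.2 hs
  have hd : ‖F w - F (c s)‖ ≤ (M + 1) * (4 * s ^ 2 * ε * N) :=
    (h.norm_image_sub_le (hball s hs') hw).trans (mul_le_mul_of_nonneg_left hwc (by linarith))
  have hupper : ∀ p ∈ closedBall z (2 * s * N), ‖F p‖ ≤ 2 * N := by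
    intro p hp
    have h1 := h.norm_sub_center_le hp
    have h2 : (M + 1) * ‖p - z‖ ≤ (M + 1) * (2 * s * N) :=
      mul_le_mul_of_nonneg_left (mem_closedBall_iff_norm.1 hp) (by linarith)
    have h3 := norm_le_norm_add_norm_sub' (F p) (F z)
    linarith
  have hu1 := hupper w hw
  have hu2 := hupper _ (hball s hs')
  have h9 : ‖F w‖ ^ 2 - ‖F (c s)‖ ^ 2 ≤ (M + 1) * (4 * s ^ 2 * ε * N) * (4 * N) := by
    have h10 := (norm_sub_norm_le (F w) (F (c s))).trans hd
    have h11 : 0 ≤ (M + 1) * (4 * s ^ 2 * ε * N) := by positivity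
    have h12 : 0 ≤ ‖F w‖ + ‖F (c s)‖ := by positivity
    calc _ = (‖F w‖ - ‖F (c s)‖) * (‖F w‖ + ‖F (c s)‖) := by ring
      _ ≤ (M + 1) * (4 * s ^ 2 * ε * N) * (‖F w‖ + ‖F (c s)‖) := by gcongr
      _ ≤ _ := by gcongr; linarith
  rw [← hNdef] at hmain
  linarith

end NearlyAffine

end Local

/-! ### One step of each method -/

section Updates

variable {E : Type*} [NormedAddCommGroup E] [InnerProductSpace ℝ E]
variable {F : E → E} {z : E} {M ε : ℝ}

namespace NearlyAffine

/-- The vanishing coefficient `(1 + (-1)) / 2` is the case `σ = -1` of `normSq_step_le`. -/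
lemma gda_approx {s : ℝ} (hs : 0 ≤ s) (hε : 0 ≤ ε)
    {w : E} (hw : w = z - s • F z) :
    ‖w - z‖ ≤ 2 * s * ‖F z‖ ∧
      ‖w - (z - s • F z + ((1 + (-1)) / 2 * s ^ 2) • fderiv ℝ F z (F z))‖
        ≤ 4 * s ^ 2 * ε * ‖F z‖ := by
  subst hw
  constructor
  · rw [sub_sub_cancel_left, norm_neg, norm_smul, Real.norm_of_nonneg hs]
    have := mul_nonneg hs (norm_nonneg (F z))
    linarith
  · simp only [add_neg_cancel, zero_div, zero_mul, zero_smul, add_zero, sub_self, norm_zero]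
    positivity

lemma egm_approx {s : ℝ} (h : NearlyAffine F z (2 * s * ‖F z‖) M ε) (hs : 0 ≤ s) (hε : 0 ≤ ε)
    (hsM : 8 * (s * (M + 1) ^ 2) ≤ ε) {w : E} (hw : w = z - s • F (z - s • F z)) :
    ‖w - z‖ ≤ 2 * s * ‖F z‖ ∧
      ‖w - (z - s • F z + ((1 + 1) / 2 * s ^ 2) • fderiv ℝ F z (F z))‖
        ≤ 4 * s ^ 2 * ε * ‖F z‖ := by
  subst hw
  have hN := norm_nonneg (F z)
  have hM := h.nonneg
  have hε1 := h.le_one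
  have hyz : ‖(z - s • F z) - z‖ = s * ‖F z‖ := by
    rw [sub_sub_cancel_left, norm_neg, norm_smul, Real.norm_of_nonneg hs]
  have hsN : 0 ≤ s * ‖F z‖ := mul_nonneg hs hN
  have hy : z - s • F z ∈ closedBall z (2 * s * ‖F z‖) :=
    mem_closedBall_iff_norm.2 (by rw [hyz]; linarith)
  constructor
  · rw [sub_sub_cancel_left, norm_neg, norm_smul, Real.norm_of_nonneg hs]
    have h1 := h.norm_sub_center_le hy
    rw [hyz] at h1
    have h2 := norm_le_norm_add_norm_sub' (F (z - s • F z)) (F z)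
    have h3 : s * (M + 1) ≤ 1 := by nlinarith
    have h4 := mul_le_mul_of_nonneg_right h3 hN
    nlinarith
  · have e : z - s • F (z - s • F z)
        - (z - s • F z + ((1 + 1) / 2 * s ^ 2) • fderiv ℝ F z (F z))
        = -(s • (F (z - s • F z) - F z - fderiv ℝ F z ((z - s • F z) - z))) := by
      rw [sub_sub_cancel_left, map_neg, map_smul]
      module
    have h1 := h.norm_taylor_le hy
    rw [hyz] at h1
    rw [e, norm_neg, norm_smul, Real.norm_of_nonneg hs]
    have h2 := mul_le_mul_of_nonneg_left h1 hs
    have h3 : 0 ≤ s * (ε * (s * ‖F z‖)) := by positivity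
    nlinarith

/-- The implicit equation has possibly several solutions `w`; only those within `2 s ‖F z‖` of `z`
are treated here, and `norm_ppm_le` shows that there are no others. -/
lemma ppm_approx {s : ℝ} (h : NearlyAffine F z (2 * s * ‖F z‖) M ε) (hs : 0 ≤ s) (hε : 0 ≤ ε)
    (hsM : 8 * (s * (M + 1) ^ 2) ≤ ε) {w : E} (hw : w = z - s • F w)
    (hwz : ‖w - z‖ ≤ 2 * s * ‖F z‖) :
    ‖w - (z - s • F z + ((1 + 1) / 2 * s ^ 2) • fderiv ℝ F z (F z))‖
        ≤ 4 * s ^ 2 * ε * ‖F z‖ := by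
  have hN := norm_nonneg (F z)
  have hM := h.nonneg
  have hwb : w ∈ closedBall z (2 * s * ‖F z‖) := mem_closedBall_iff_norm.2 hwz
  have hwz' : w - z = -(s • F w) := by rw [sub_eq_iff_eq_add, neg_add_eq_sub]; exact hw
  have e : w - (z - s • F z + ((1 + 1) / 2 * s ^ 2) • fderiv ℝ F z (F z))
      = -(s • ((F w - F z - fderiv ℝ F z (w - z)) - s • fderiv ℝ F z (F w - F z))) := by
    have : w - (z - s • F z + ((1 + 1) / 2 * s ^ 2) • fderiv ℝ F z (F z))
      = (w - z) + s • F z - ((1 + 1) / 2 * s ^ 2) • fderiv ℝ F z (F z) := by abel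
    rw [this, hwz', map_neg, map_smul, map_sub]
    module
  have h1 := (h.norm_taylor_le hwb).trans (mul_le_mul_of_nonneg_left hwz hε)
  have h2 : ‖fderiv ℝ F z (F w - F z)‖ ≤ (M + 1) * ((M + 1) * (2 * s * ‖F z‖)) :=
    (ContinuousLinearMap.le_opNorm _ _).trans <|
      mul_le_mul (h.norm_fderiv_le.trans (by linarith))
        ((h.norm_sub_center_le hwb).trans (mul_le_mul_of_nonneg_left hwz (by linarith)))
        (norm_nonneg _) (by linarith)
  have h3 : ‖(F w - F z - fderiv ℝ F z (w - z)) - s • fderiv ℝ F z (F w - F z)‖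
      ≤ ε * (2 * s * ‖F z‖) + s * ((M + 1) * ((M + 1) * (2 * s * ‖F z‖))) := by
    refine (norm_sub_le _ _).trans (add_le_add h1 ?_)
    rw [norm_smul, Real.norm_of_nonneg hs]
    exact mul_le_mul_of_nonneg_left h2 hs
  rw [e, norm_neg, norm_smul, Real.norm_of_nonneg hs]
  have h4 := mul_le_mul_of_nonneg_left h3 hs
  have h5 := mul_le_mul_of_nonneg_right hsM (by positivity : 0 ≤ s * (s * ‖F z‖))
  have h6 : 0 ≤ ε * (s * (s * ‖F z‖)) := by positivity
  nlinarith

/-- The Jacobian step follows the field `DF F` exactly to first order, along a straight line. Its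
guaranteed gain is of order `s`, so an error `O(s ε)` is good enough. -/
lemma normSq_jm_le {s : ℝ} (h : NearlyAffine F z ((M + 1) * s * ‖F z‖) M ε) (hs : 0 ≤ s)
    (hsM : 4 * (s * (M + 1) ^ 3) ≤ ε) {ρ : ℝ} (hρ : 0 ≤ ρ)
    (hcond : ∀ p, ρ / 2 * ‖F p‖ ^ 2 ≤ -⟪F p, fderiv ℝ F p (fderiv ℝ F p (F p))⟫)
    {w : E} (hw : w = z + s • fderiv ℝ F z (F z)) :
    ‖w - z‖ ≤ (M + 1) * s * ‖F z‖ ∧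
    ‖F w‖ ^ 2 ≤ (1 - s * ρ / 2 + 8 * (M + 1) * ε * s) * ‖F z‖ ^ 2 := by
  have hN := norm_nonneg (F z)
  have hM := h.nonneg
  have hJ : ‖fderiv ℝ F z (F z)‖ ≤ (M + 1) * ‖F z‖ :=
    (ContinuousLinearMap.le_opNorm _ _).trans
      (mul_le_mul_of_nonneg_right (h.norm_fderiv_le.trans (by linarith)) hN)
  set c : ℝ → E := fun t => z + t • fderiv ℝ F z (F z) with hcdef
  have hball' : ∀ t ∈ Icc 0 s, ‖c t - z‖ ≤ (M + 1) * s * ‖F z‖ := by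
    intro t ht
    simp only [hcdef, add_sub_cancel_left]
    rw [norm_smul, Real.norm_of_nonneg ht.1]
    calc t * ‖fderiv ℝ F z (F z)‖ ≤ s * ((M + 1) * ‖F z‖) :=
          mul_le_mul ht.2 hJ (norm_nonneg _) hs
      _ = _ := by ring
  have hball : ∀ t ∈ Icc 0 s, c t ∈ closedBall z ((M + 1) * s * ‖F z‖) := fun t ht =>
    mem_closedBall_iff_norm.2 (hball' t ht)
  have hw' : w = c s := hw
  rw [hw']
  refine ⟨hball' s (right_mem_Icc.2 hs), ?_⟩
  have hc : ∀ t, HasDerivAt c ((fun _ => fderiv ℝ F z (F z)) t) t := by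
    intro t
    simpa [hcdef] using ((hasDerivAt_id t).smul_const (fderiv ℝ F z (F z))).const_add z
  have hε1 := h.le_one
  have hR : 4 * ((M + 1) * ((M + 1) * s * ‖F z‖)) ≤ ‖F z‖ := by
    have h1 : s * (M + 1) ^ 2 ≤ s * (M + 1) ^ 3 :=
      mul_le_mul_of_nonneg_left (pow_le_pow_right₀ (by linarith) (by norm_num)) hs
    have h2 := mul_le_mul_of_nonneg_right (by linarith : 4 * (s * (M + 1) ^ 2) ≤ 1) hN
    linarith
  have := h.normSq_le_of_curve (η := 2 * ε) hs hρ hR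
    (W := fun p => fderiv ℝ F p (F p)) (fun p _ => hcond p) hc (by simp [hcdef]) hball
    (fun t ht => by
      refine (h.norm_apply_sub_le (hball t ht)).trans ?_
      have h1 := mul_le_mul_of_nonneg_left (hball' t ht) (by positivity : 0 ≤ (M + 1) ^ 2)
      have h2 := mul_le_mul_of_nonneg_right hsM hN
      have h3 : 0 ≤ s * (M + 1) ^ 3 * ‖F z‖ := by positivity
      nlinarith)
  linarith

end NearlyAffine

end Updates

/-! ### From one step to the whole run -/

lemma exists_zero_of_geometric {E : Type*} [NormedAddCommGroup E] [CompleteSpace E]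
    {F : E → E} (hF : Continuous F) {u : ℕ → E} {θ C C' : ℝ}
    (hθ0 : 0 < θ) (hθ1 : θ < 1) (hu : ∀ k, ‖u (k + 1) - u k‖ ≤ C * θ ^ k)
    (hFu : ∀ k, ‖F (u k)‖ ≤ C' * θ ^ k) :
    ∃ zs, F zs = 0 ∧ ∃ θ C : ℝ, 0 < θ ∧ θ < 1 ∧ ∀ k : ℕ, ‖u k - zs‖ ≤ C * θ ^ k := by
  have hu' : ∀ k, dist (u k) (u (k + 1)) ≤ C * θ ^ k := fun k => by
    rw [dist_comm, dist_eq_norm]; exact hu k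
  obtain ⟨zs, hzs⟩ := cauchySeq_tendsto_of_complete (cauchySeq_of_le_geometric θ C hθ1 hu')
  refine ⟨zs, ?_, θ, C / (1 - θ), hθ0, hθ1, fun k => ?_⟩
  · have h1 : Tendsto (fun k => F (u k)) atTop (𝓝 (F zs)) := (hF.tendsto zs).comp hzs
    have h2 : Tendsto (fun k => C' * θ ^ k) atTop (𝓝 0) := by
      simpa using (tendsto_pow_atTop_nhds_zero_of_lt_one hθ0.le hθ1).const_mul C'
    exact tendsto_nhds_unique h1 (squeeze_zero_norm hFu h2)
  · have := dist_le_of_le_geometric_of_tendsto θ C hθ1 hu' hzs k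
    rw [dist_eq_norm] at this
    calc _ ≤ _ := this
      _ = _ := by ring

section Global

variable {E : Type*} [NormedAddCommGroup E] [InnerProductSpace ℝ E] {F : E → E}

/-- A ball about `z` stays in a sublevel set of `‖F‖` if the derivative bound on the sublevel set
would not let `‖F‖` reach the level within the ball. The bound is assumed on the sublevel set only:
a path leaving the set would have to cross its boundary with too small a speed. The constant
`M + 1` makes the comparison strict. -/
lemma norm_le_of_mem_closedBall (hF : Differentiable ℝ F) {b M R : ℝ} (hM0 : 0 ≤ M)
    (hM : ∀ z, ‖F z‖ ≤ b → ‖fderiv ℝ F z‖ ≤ M) {z a : E}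
    (hz : ‖F z‖ + (M + 1) * R ≤ b) (ha : a ∈ closedBall z R) : ‖F a‖ ≤ b := by
  have haz := mem_closedBall_iff_norm.1 ha
  have hR : 0 ≤ R := (norm_nonneg _).trans haz
  rcases eq_or_ne a z with rfl | hne
  · have : 0 ≤ (M + 1) * R := by positivity
    linarith
  have hpos : 0 < ‖a - z‖ := norm_pos_iff.2 (sub_ne_zero.2 hne)
  have hle : (M + 1) * ‖a - z‖ ≤ (M + 1) * R := mul_le_mul_of_nonneg_left haz (by linarith)
  have hderiv : ∀ t : ℝ, HasDerivAt (fun t : ℝ => F (z + t • (a - z)))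
      (fderiv ℝ F (z + t • (a - z)) (a - z)) t := fun t =>
    (hF _).hasFDerivAt.comp_hasDerivAt t
      (by simpa using ((hasDerivAt_id t).smul_const (a - z)).const_add z)
  have hB : ∀ t : ℝ, HasDerivAt (fun t : ℝ => ‖F z‖ + t * ((M + 1) * ‖a - z‖))
      ((M + 1) * ‖a - z‖) t := fun t => by
    simpa using ((hasDerivAt_id t).mul_const ((M + 1) * ‖a - z‖)).const_add ‖F z‖
  have key := image_norm_le_of_norm_deriv_right_lt_deriv_boundary'
    (a := 0) (b := 1) (f := fun t : ℝ => F (z + t • (a - z)))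
    (fun t _ => (hderiv t).continuousAt.continuousWithinAt)
    (fun t _ => (hderiv t).hasDerivWithinAt)
    (B := fun t => ‖F z‖ + t * ((M + 1) * ‖a - z‖)) (B' := fun _ => (M + 1) * ‖a - z‖)
    (by simp) (fun t _ => (hB t).continuousAt.continuousWithinAt)
    (fun t _ => (hB t).hasDerivWithinAt)
    (fun t ht heq => by
      have h1 : ‖F (z + t • (a - z))‖ ≤ b := by
        rw [heq]
        have : t * ((M + 1) * ‖a - z‖) ≤ 1 * ((M + 1) * ‖a - z‖) :=
          mul_le_mul_of_nonneg_right ht.2.le (by positivity)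
        linarith
      calc _ ≤ ‖fderiv ℝ F (z + t • (a - z))‖ * ‖a - z‖ := ContinuousLinearMap.le_opNorm _ _
        _ ≤ M * ‖a - z‖ := mul_le_mul_of_nonneg_right (hM _ h1) hpos.le
        _ < _ := by linarith)
  have := key (right_mem_Icc.2 zero_le_one)
  simp only [one_smul, add_sub_cancel, one_mul] at this
  linarith

lemma eventually_mul_le (A : ℝ) {b : ℝ} (hb : 0 < b) : ∀ᶠ s in 𝓝[>] (0 : ℝ), s * A ≤ b := by
  have : Tendsto (fun s : ℝ => s * A) (𝓝[>] 0) (𝓝 (0 * A)) :=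
    ((continuous_id.mul continuous_const).tendsto 0).mono_left nhdsWithin_le_nhds
  rw [zero_mul] at this
  exact this.eventually_le_const hb

lemma one_sub_pow_mul_le_one {x : ℝ} (hx0 : 0 ≤ x) (hx1 : x ≤ 1) (k : ℕ) :
    (1 - x) ^ k * (1 + k * x) ≤ 1 := by
  calc (1 - x) ^ k * (1 + k * x) ≤ (1 - x) ^ k * (1 + x) ^ k :=
        mul_le_mul_of_nonneg_left (one_add_mul_le_pow (by linarith) k)
          (pow_nonneg (by linarith) k)
    _ = (1 - x ^ 2) ^ k := by rw [← mul_pow]; ring_nf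
    _ ≤ 1 := pow_le_one₀ (by nlinarith) (by nlinarith)

/-- For small `s`, `F` is nearly affine around every point that a run can visit. No bound is
available outside the sublevel set of `z0`, but a run decreasing `‖F‖ ^ 2` by a factor
`1 - d s² / 4` needs at most `O(1 / s)` steps until the relevant balls lie inside the sublevel set,
where the second derivative is bounded. Meanwhile it travels a distance `O(1)`, hence stays in a
ball about `z0` that does not depend on `s`, and on this compact ball the derivative is uniformly
continuous. -/
lemma eventually_nearlyAffine [FiniteDimensional ℝ E] (hF : Differentiable ℝ F)
    (hF2 : Differentiable ℝ (fderiv ℝ F)) {z0 : E} {M M2 : ℝ}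
    (hM : ∀ z, ‖F z‖ ≤ ‖F z0‖ → ‖fderiv ℝ F z‖ ≤ M)
    (hM2 : ∀ z, ‖F z‖ ≤ ‖F z0‖ → ‖fderiv ℝ (fderiv ℝ F) z‖ ≤ M2)
    {ε d r : ℝ} (hε : 0 < ε) (hε1 : ε ≤ 1) (hd : 0 < d) (hr : 0 ≤ r) :
    ∀ᶠ s in 𝓝[>] (0 : ℝ), ∀ (z : E) (k : ℕ),
      ‖F z‖ ^ 2 ≤ (1 - d * s ^ 2 / 4) ^ k * ‖F z0‖ ^ 2 →
      ‖z - z0‖ ≤ k * (r * s * ‖F z0‖) → NearlyAffine F z (r * s * ‖F z‖) M ε := by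
  have hM0 : 0 ≤ M := (norm_nonneg _).trans (hM z0 le_rfl)
  set κ := (M + 1) * r with hκ
  have hκ0 : 0 ≤ κ := by positivity
  set R := 12 * κ / d * (r * ‖F z0‖) with hR
  have huc : UniformContinuousOn (fderiv ℝ F) (closedBall z0 (R + 1)) :=
    (isCompact_closedBall z0 (R + 1)).uniformContinuousOn_of_continuous hF2.continuous.continuousOn
  obtain ⟨δ, hδ, huc⟩ := Metric.uniformContinuousOn_iff.1 huc ε hε
  filter_upwards [self_mem_nhdsWithin, eventually_mul_le κ one_pos,
    eventually_mul_le (r * ‖F z0‖) one_pos, eventually_mul_le (r * ‖F z0‖) (half_pos hδ),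
    eventually_mul_le (M2 * (r * ‖F z0‖)) hε, eventually_mul_le d one_pos,
    eventually_mul_le 1 one_pos] with s hs hs1 hs2 hs3 hs4 hs5 hs6 z k hz hdist
  have hs : 0 < s := hs
  have hN := norm_nonneg (F z)
  have hN0 := norm_nonneg (F z0)
  have hx1 : d * s ^ 2 / 4 ≤ 1 := by nlinarith
  have hx0 : 0 ≤ d * s ^ 2 / 4 := by positivity
  have hzle : ‖F z‖ ≤ ‖F z0‖ := by
    refine (sq_le_sq₀ hN hN0).1 (hz.trans ?_)
    exact mul_le_of_le_one_left (sq_nonneg _) (pow_le_one₀ (by linarith) (by linarith))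
  have hrad : r * s * ‖F z‖ ≤ s * (r * ‖F z0‖) := by
    have := mul_le_mul_of_nonneg_left hzle (mul_nonneg hr hs.le)
    linarith
  have hrad0 : 0 ≤ r * s * ‖F z‖ := by positivity
  refine ⟨hF, hM z hzle, hε1, fun a ha => ?_⟩
  by_cases hcase : ‖F z‖ + (M + 1) * (r * s * ‖F z‖) ≤ ‖F z0‖
  · -- The ball lies in the sublevel set, where `M2` bounds the second derivative.
    have h1 := (convex_closedBall z (r * s * ‖F z‖)).norm_image_sub_le_of_norm_hasFDerivWithin_le
      (f := fderiv ℝ F) (C := M2) (fun x _ => (hF2 x).hasFDerivAt.hasFDerivWithinAt)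
      (fun x hx => hM2 x (norm_le_of_mem_closedBall hF hM0 hM hcase hx))
      (mem_closedBall_self hrad0) ha
    have hM20 : 0 ≤ M2 := (norm_nonneg (fderiv ℝ (fderiv ℝ F) z)).trans (hM2 z hzle)
    have h2 := mul_le_mul_of_nonneg_left ((mem_closedBall_iff_norm.1 ha).trans hrad) hM20
    linarith
  · -- The run is still near the boundary of the sublevel set, which bounds `k * s`.
    rw [not_le] at hcase
    have hN0pos : 0 < ‖F z0‖ := by
      rcases hN0.eq_or_lt with h | h
      · have : ‖F z‖ = 0 := by linarith
        rw [this] at hcase; linarith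
      · exact h
    -- With `x = d s² / 4`, the decay gives `1 ≤ (1 + κ s)² (1 - x) ^ k ≤ (1 + 3 κ s) / (1 + k x)`.
    have hks : k * s ≤ 12 * κ / d := by
      have h1 : ‖F z0‖ ^ 2 ≤ (1 + κ * s) ^ 2 * ‖F z‖ ^ 2 := by
        rw [← mul_pow]
        refine pow_le_pow_left₀ hN0 ?_ 2
        rw [hκ]; linarith
      have h2 : ‖F z0‖ ^ 2 ≤ ((1 + κ * s) ^ 2 * (1 - d * s ^ 2 / 4) ^ k) * ‖F z0‖ ^ 2 := by
        rw [mul_assoc]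
        exact h1.trans (mul_le_mul_of_nonneg_left hz (sq_nonneg _))
      have h3 : 1 ≤ (1 + κ * s) ^ 2 * (1 - d * s ^ 2 / 4) ^ k := by
        by_contra hcon
        rw [not_le] at hcon
        have := mul_lt_mul_of_pos_right hcon (by positivity : 0 < ‖F z0‖ ^ 2)
        linarith
      have h4 := one_sub_pow_mul_le_one hx0 hx1 k
      have h5 : 1 + k * (d * s ^ 2 / 4) ≤ (1 + κ * s) ^ 2 := by
        have h6 : 0 ≤ 1 + k * (d * s ^ 2 / 4) := by positivity
        have h7 := mul_le_mul_of_nonneg_right h3 h6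
        have h8 := mul_le_mul_of_nonneg_left h4 (sq_nonneg (1 + κ * s))
        nlinarith
      have h9 : κ * s * (κ * s) ≤ κ * s * 1 :=
        mul_le_mul_of_nonneg_left (by linarith) (by positivity)
      have h10 : s * (k * s * d) ≤ s * (12 * κ) := by nlinarith
      rw [le_div_iff₀ hd]
      exact le_of_mul_le_mul_left h10 hs
    have hzR : ‖z - z0‖ ≤ R := by
      refine hdist.trans ?_
      have := mul_le_mul_of_nonneg_right hks (by positivity : 0 ≤ r * ‖F z0‖)
      rw [hR]; linarith
    have haz := (mem_closedBall_iff_norm.1 ha).trans hrad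
    have h1 : a ∈ closedBall z0 (R + 1) := by
      rw [mem_closedBall_iff_norm]
      have := norm_sub_le_norm_sub_add_norm_sub a z z0
      linarith
    have h2 : z ∈ closedBall z0 (R + 1) := mem_closedBall_iff_norm.2 (by linarith)
    have h3 := huc a h1 z h2 (by rw [dist_eq_norm]; linarith)
    rw [dist_eq_norm] at h3
    exact h3.le

/-- If every step from a nearly affine point of the sublevel set moves by at most `r s ‖F z‖` and
multiplies `‖F‖ ^ 2` by at most `1 - s ρ(s) / 4`, with `ρ(s) ≥ d s`, then all runs from `z0`
converge linearly to zeros of `F`. The points of a run converge with the rate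
`√(1 - d s² / 4)`, which is available even when `1 - s ρ(s) / 4` is negative (this can happen
only if `F z0 = 0`). -/
theorem eventually_run_converges [FiniteDimensional ℝ E] (hF : Differentiable ℝ F)
    (hF2 : Differentiable ℝ (fderiv ℝ F)) {z0 : E} {M M2 : ℝ}
    (hM : ∀ z, ‖F z‖ ≤ ‖F z0‖ → ‖fderiv ℝ F z‖ ≤ M)
    (hM2 : ∀ z, ‖F z‖ ≤ ‖F z0‖ → ‖fderiv ℝ (fderiv ℝ F) z‖ ≤ M2)
    {ε d r : ℝ} (hε : 0 < ε) (hε1 : ε ≤ 1) (hd : 0 < d) (hr : 0 ≤ r) {ρ : ℝ → ℝ}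
    {step : ℝ → E → E → Prop}
    (hρ : ∀ᶠ s in 𝓝[>] (0 : ℝ), d * s ≤ ρ s)
    (hq : F z0 ≠ 0 → ∀ᶠ s in 𝓝[>] (0 : ℝ), s * ρ s ≤ 4)
    (hex : ∀ᶠ s in 𝓝[>] (0 : ℝ), ∀ z, ‖F z‖ ≤ ‖F z0‖ → ∃ w, step s z w)
    (hstep : ∀ᶠ s in 𝓝[>] (0 : ℝ), ∀ z w, ‖F z‖ ≤ ‖F z0‖ →
      NearlyAffine F z (r * s * ‖F z‖) M ε → step s z w →
      ‖w - z‖ ≤ r * s * ‖F z‖ ∧ ‖F w‖ ^ 2 ≤ (1 - s * ρ s / 4) * ‖F z‖ ^ 2) :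
    ∀ᶠ s in 𝓝[>] (0 : ℝ), (∃ u : ℕ → E, u 0 = z0 ∧ ∀ k, step s (u k) (u (k + 1))) ∧
      ∀ u : ℕ → E, u 0 = z0 → (∀ k, step s (u k) (u (k + 1))) →
        (∀ k, ‖F (u k)‖ ^ 2 ≤ (1 - s * ρ s / 4) ^ k * ‖F z0‖ ^ 2) ∧
        ∃ zs, F zs = 0 ∧ ∃ θ C : ℝ, 0 < θ ∧ θ < 1 ∧ ∀ k : ℕ, ‖u k - zs‖ ≤ C * θ ^ k := by
  have hq' : ∀ᶠ s in 𝓝[>] (0 : ℝ), F z0 ≠ 0 → s * ρ s ≤ 4 := by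
    by_cases h : F z0 = 0
    · exact Eventually.of_forall fun s h' => absurd h h'
    · exact (hq h).mono fun s hs _ => hs
  filter_upwards [self_mem_nhdsWithin, hρ, hq', hex, hstep,
    eventually_nearlyAffine hF hF2 hM hM2 hε hε1 hd hr, eventually_mul_le d one_pos,
    eventually_mul_le 1 one_pos] with s hs hρ hq hex hstep haff hs1 hs2
  have hs : 0 < s := hs
  have hx1 : d * s ^ 2 / 4 < 1 := by nlinarith
  have hx0 : 0 < d * s ^ 2 / 4 := by positivity
  have hqx : 1 - s * ρ s / 4 ≤ 1 - d * s ^ 2 / 4 := by nlinarith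
  have hN0 := norm_nonneg (F z0)
  set q := 1 - s * ρ s / 4 with hqdef
  set p := 1 - d * s ^ 2 / 4 with hpdef
  have hp0 : 0 < p := by linarith
  have hp1 : p < 1 := by linarith
  have hsub : ∀ (z : E) (k : ℕ), ‖F z‖ ^ 2 ≤ p ^ k * ‖F z0‖ ^ 2 → ‖F z‖ ≤ ‖F z0‖ := by
    intro z k hz
    refine (sq_le_sq₀ (norm_nonneg _) hN0).1 (hz.trans ?_)
    exact mul_le_of_le_one_left (sq_nonneg _) (pow_le_one₀ hp0.le hp1.le)
  have hind : ∀ (u : ℕ → E) (k : ℕ), u 0 = z0 → (∀ j < k, step s (u j) (u (j + 1))) →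
      ‖F (u k)‖ ^ 2 ≤ q ^ k * ‖F z0‖ ^ 2 ∧ ‖F (u k)‖ ^ 2 ≤ p ^ k * ‖F z0‖ ^ 2 ∧
      ‖u k - z0‖ ≤ k * (r * s * ‖F z0‖) := by
    intro u k hu0
    induction k with
    | zero => intro _; simp [hu0]
    | succ k ih =>
      intro hu
      obtain ⟨h1, h2, h3⟩ := ih fun j hj => hu j (hj.trans k.lt_succ_self)
      have hz := hsub _ _ h2
      obtain ⟨h4, h5⟩ := hstep _ _ hz (haff _ k h2 h3) (hu k k.lt_succ_self)
      have h6 : ‖F (u (k + 1))‖ ^ 2 ≤ p ^ (k + 1) * ‖F z0‖ ^ 2 := by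
        calc _ ≤ q * ‖F (u k)‖ ^ 2 := h5
          _ ≤ p * ‖F (u k)‖ ^ 2 := mul_le_mul_of_nonneg_right hqx (sq_nonneg _)
          _ ≤ p * (p ^ k * ‖F z0‖ ^ 2) := mul_le_mul_of_nonneg_left h2 hp0.le
          _ = _ := by ring
      refine ⟨?_, h6, ?_⟩
      · by_cases hz0 : F z0 = 0
        · simpa [hz0] using h6
        · have hq0 : 0 ≤ q := by linarith [hq hz0]
          calc _ ≤ q * ‖F (u k)‖ ^ 2 := h5
            _ ≤ q * (q ^ k * ‖F z0‖ ^ 2) := mul_le_mul_of_nonneg_left h1 hq0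
            _ = _ := by ring
      · have h7 := norm_sub_le_norm_sub_add_norm_sub (u (k + 1)) (u k) z0
        have h8 := mul_le_mul_of_nonneg_left hz (mul_nonneg hr hs.le)
        push_cast
        linarith
  refine ⟨?_, fun u hu0 hu => ⟨fun k => (hind u k hu0 fun j _ => hu j).1, ?_⟩⟩
  · classical
    let g : E → E := fun z => if h : ∃ w, step s z w then h.choose else z
    have hg : ∀ z, ‖F z‖ ≤ ‖F z0‖ → step s z (g z) := fun z hz => by
      simp only [g, dif_pos (hex z hz)]
      exact (hex z hz).choose_spec
    let u : ℕ → E := fun k => g^[k] z0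
    have hus : ∀ k, ∀ j < k, step s (u j) (u (j + 1)) := by
      intro k
      induction k with
      | zero => intro j hj; exact absurd hj (Nat.not_lt_zero j)
      | succ k ih =>
        intro j hj
        rcases Nat.lt_succ_iff_lt_or_eq.1 hj with h | rfl
        · exact ih j h
        · have := hg (u j) (hsub _ j (hind u j rfl ih).2.1)
          simpa only [u, Function.iterate_succ_apply'] using this
    exact ⟨u, rfl, fun k => hus (k + 1) k k.lt_succ_self⟩
  · have hall := fun k => hind u k hu0 fun j _ => hu j
    have hθ : ∀ k, ‖F (u k)‖ ≤ ‖F z0‖ * √p ^ k := by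
      intro k
      refine (sq_le_sq₀ (norm_nonneg _) (by positivity)).1 ((hall k).2.1.trans_eq ?_)
      rw [mul_pow, ← pow_mul, mul_comm k 2, pow_mul, Real.sq_sqrt hp0.le]
      ring
    have hsqrt1 : √p < 1 := by
      rw [Real.sqrt_lt' one_pos]; linarith
    refine exists_zero_of_geometric hF.continuous (Real.sqrt_pos.2 hp0) hsqrt1
      (C := r * s * ‖F z0‖) (fun k => ?_) hθ
    obtain ⟨_, h2, h3⟩ := hall k
    refine (hstep _ _ (hsub _ _ h2) (haff _ k h2 h3) (hu k)).1.trans ?_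
    rw [mul_assoc _ ‖F z0‖]
    exact mul_le_mul_of_nonneg_left (hθ k) (by positivity)

/-- Solvability of `w = z - s F(w)` by continuation in the step-size, starting from `w = z` at
step-size `0`. The set of solvable step-sizes is closed because the a priori bound keeps solutions
in a compact ball, and open because `(t, w) ↦ (t, w + t F(w))` is a submersion at solutions. -/
lemma exists_proximal_point [FiniteDimensional ℝ E] (hF : ContDiff ℝ 1 F) {z : E} {s M : ℝ}
    (hs : 0 ≤ s) (hsM : s * M ≤ 1 / 2)
    (hapriori : ∀ t ∈ Icc 0 s, ∀ w, w = z - t • F w →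
      ‖fderiv ℝ F w‖ ≤ M ∧ ‖F w‖ ≤ 2 * ‖F z‖) :
    ∃ w, w = z - s • F w := by
  set T : Set ℝ := {t | ∃ w, w = z - t • F w} with hT
  have hclosed : IsClosed (T ∩ Icc 0 s) := by
    have hK : IsCompact ((Icc 0 s ×ˢ closedBall z (s * (2 * ‖F z‖))) ∩
        {x : ℝ × E | x.2 = z - x.1 • F x.2}) := by
      refine (isCompact_Icc.prod (isCompact_closedBall z _)).inter_right ?_
      exact isClosed_eq continuous_snd
        (continuous_const.sub (continuous_fst.smul (hF.continuous.comp continuous_snd)))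
    have : T ∩ Icc 0 s = Prod.fst '' ((Icc 0 s ×ˢ closedBall z (s * (2 * ‖F z‖))) ∩
        {x : ℝ × E | x.2 = z - x.1 • F x.2}) := by
      ext t
      constructor
      · rintro ⟨⟨w, hw⟩, ht⟩
        refine ⟨(t, w), ⟨⟨ht, ?_⟩, hw⟩, rfl⟩
        have hwz : w - z = -(t • F w) := by rw [sub_eq_iff_eq_add, neg_add_eq_sub]; exact hw
        rw [mem_closedBall_iff_norm, hwz, norm_neg, norm_smul, Real.norm_of_nonneg ht.1]
        exact mul_le_mul ht.2 (hapriori t ht w hw).2 (norm_nonneg _) hs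
      · rintro ⟨⟨t', w⟩, ⟨⟨ht, _⟩, hw⟩, rfl⟩
        exact ⟨⟨w, hw⟩, ht⟩
    rw [this]
    exact (hK.image continuous_fst).isClosed
  have hsub := hclosed.Icc_subset_of_forall_mem_nhdsWithin ⟨z, by simp⟩ ?_
  · exact hsub (right_mem_Icc.2 hs)
  rintro t ⟨⟨w, hw⟩, ht⟩
  have hJ := (hapriori t ⟨ht.1, ht.2.le⟩ w hw).1
  have hstrict : HasStrictFDerivAt F (fderiv ℝ F w) w :=
    hF.contDiffAt.hasStrictFDerivAt one_ne_zero
  have hΦ := (hasStrictFDerivAt_fst (𝕜 := ℝ) (p := (t, w))).prodMk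
    ((hasStrictFDerivAt_snd (𝕜 := ℝ) (p := (t, w))).add
      ((hasStrictFDerivAt_fst (𝕜 := ℝ) (p := (t, w))).smul
        (HasStrictFDerivAt.comp (t, w) (g := F) (f := Prod.snd) hstrict hasStrictFDerivAt_snd)))
  have hinj : Function.Injective (LinearMap.id + t • (fderiv ℝ F w).toLinearMap : E →ₗ[ℝ] E) := by
    rw [injective_iff_map_eq_zero]
    intro v hv
    have h1 : v = -(t • fderiv ℝ F w v) := eq_neg_of_add_eq_zero_left hv
    have h2 : ‖v‖ ≤ 1 / 2 * ‖v‖ := by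
      calc ‖v‖ = t * ‖fderiv ℝ F w v‖ := by
            conv_lhs => rw [h1, norm_neg, norm_smul, Real.norm_of_nonneg ht.1]
        _ ≤ s * (M * ‖v‖) := mul_le_mul ht.2.le
            ((ContinuousLinearMap.le_opNorm _ _).trans
              (mul_le_mul_of_nonneg_right hJ (norm_nonneg _))) (norm_nonneg _) hs
        _ ≤ _ := by
            rw [← mul_assoc]
            exact mul_le_mul_of_nonneg_right hsM (norm_nonneg _)
    exact norm_eq_zero.1 (by linarith [norm_nonneg v])
  have hsurj := LinearMap.injective_iff_surjective.1 hinj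
  have hmap := hΦ.map_nhds_eq_of_surj (by
    rw [LinearMap.range_eq_top]
    rintro ⟨τ, v⟩
    obtain ⟨x, hx⟩ := hsurj (v - τ • F w)
    refine ⟨(τ, x), ?_⟩
    have hx' : x + t • fderiv ℝ F w x = v - τ • F w := hx
    rw [eq_sub_iff_add_eq] at hx'
    simp [← hx', add_assoc])
  have himg : Set.range (fun x : ℝ × E => (x.1, x.2 + x.1 • F x.2)) ∈ 𝓝 (t, z) := by
    have hz : w + t • F w = z := by
      rw [← eq_sub_iff_add_eq]; exact hw
    have h1 := image_mem_map (m := fun x : ℝ × E => (x.1, x.2 + x.1 • F x.2))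
      (univ_mem : (univ : Set (ℝ × E)) ∈ 𝓝 (t, w))
    rw [image_univ] at h1
    have h2 : map (fun x : ℝ × E => (x.1, x.2 + x.1 • F x.2)) (𝓝 (t, w)) = 𝓝 (t, z) := by
      rw [← hz]; exact hmap
    rwa [h2] at h1
  have hcont : Tendsto (fun t' : ℝ => (t', z)) (𝓝 t) (𝓝 (t, z)) :=
    (continuous_id.prodMk continuous_const).tendsto t
  refine mem_nhdsWithin_of_mem_nhds (mem_of_superset (hcont himg) ?_)
  rintro t' ⟨⟨t'', w'⟩, hw'⟩
  simp only [Prod.mk.injEq] at hw'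
  obtain ⟨rfl, hw'⟩ := hw'
  exact ⟨w', by rw [eq_sub_iff_add_eq]; exact hw'⟩

end Global

/-! ### The derivative of the saddle field -/

section SaddleField

lemma differentiable_fderiv_of_iteratedFDeriv_one {E G : Type*} [NormedAddCommGroup E]
    [NormedSpace ℝ E] [NormedAddCommGroup G] [NormedSpace ℝ G] {g : E → G}
    (h : Differentiable ℝ (iteratedFDeriv ℝ 1 g)) : Differentiable ℝ (fderiv ℝ g) := by
  have e : fderiv ℝ g = continuousMultilinearCurryFin1 ℝ E G ∘ iteratedFDeriv ℝ 1 g := by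
    ext x v
    simp
  rw [e]
  exact (continuousMultilinearCurryFin1 ℝ E G).differentiable.comp h

variable {n m : ℕ}

lemma TimesDifferentiable.mono {j k : ℕ} {f : Pt n m → ℝ} (h : TimesDifferentiable k f)
    (hjk : j ≤ k) : TimesDifferentiable j f := fun i hi => h i (hi.trans_le hjk)

/-- The continuous linear map taking a differential to the gradient with its `y`-part negated, so
that `field L z` is its value at `fderiv ℝ L z`. -/
noncomputable def fieldCLM (n m : ℕ) : (Pt n m →L[ℝ] ℝ) →L[ℝ] Pt n m :=
  LinearMap.toContinuousLinearMap
    { toFun := fun φ => WithLp.toLp 2 (Sum.elim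
        (fun i : Fin n => φ (basisVec (Sum.inl i)))
        (fun j : Fin m => -(φ (basisVec (Sum.inr j)))))
      map_add' := fun φ ψ => by
        ext i; rcases i with i | i <;> simp [add_comm]
      map_smul' := fun c φ => by
        ext i; rcases i with i | i <;> simp }

variable {L : Pt n m → ℝ}

lemma TimesDifferentiable.differentiable_fderiv (h : TimesDifferentiable 3 L) :
    Differentiable ℝ L ∧ Differentiable ℝ (fderiv ℝ L) ∧
      Differentiable ℝ (fderiv ℝ (fderiv ℝ L)) := by
  have h2 : ContDiff ℝ 2 L := contDiff_of_differentiable_iteratedFDeriv (n := 2) fun k hk =>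
    h k (Nat.lt_succ_of_le (by exact_mod_cast hk))
  refine ⟨h2.differentiable (by norm_num),
    (h2.fderiv_right (m := 1) (by norm_num)).differentiable (by norm_num), ?_⟩
  have h3 := h 2 (by norm_num)
  have e2 : iteratedFDeriv ℝ 2 L = _ ∘ iteratedFDeriv ℝ 1 (fderiv ℝ L) :=
    funext fun _ => iteratedFDeriv_succ_eq_comp_right
  rw [e2, LinearIsometryEquiv.comp_differentiable_iff] at h3
  exact differentiable_fderiv_of_iteratedFDeriv_one h3

lemma hasFDerivAt_field (h : TimesDifferentiable 3 L) (z : Pt n m) :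
    HasFDerivAt (field L) ((fieldCLM n m).comp (fderiv ℝ (fderiv ℝ L) z)) z :=
  (fieldCLM n m).hasFDerivAt.comp z (h.differentiable_fderiv.2.1 z).hasFDerivAt

lemma differentiable_field (h : TimesDifferentiable 3 L) : Differentiable ℝ (field L) :=
  fun z => (hasFDerivAt_field h z).differentiableAt

lemma differentiable_fderiv_field (h : TimesDifferentiable 3 L) :
    Differentiable ℝ (fderiv ℝ (field L)) := by
  have : fderiv ℝ (field L) = fun z => (fieldCLM n m).comp (fderiv ℝ (fderiv ℝ L) z) :=
    funext fun z => (hasFDerivAt_field h z).fderiv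
  rw [this]
  exact (differentiable_const _).clm_comp h.differentiable_fderiv.2.2

lemma hessian_isSymm (h : TimesDifferentiable 3 L) (z : Pt n m) : (hessian L z).IsSymm := by
  ext i j
  exact second_derivative_symmetric (fun y => (h.differentiable_fderiv.1 y).hasFDerivAt)
    (h.differentiable_fderiv.2.1 z).hasFDerivAt _ _

/-- The Jacobian matrix of `field L` in block form, `[A, B; -Bᵀ, C]`. -/
noncomputable def jacobian (L : Pt n m → ℝ) (z : Pt n m) : Matrix (Fin n ⊕ Fin m) (Fin n ⊕ Fin m) ℝ :=
  Matrix.fromBlocks (blockA L z) (blockB L z) (-(blockB L z).transpose) (blockC L z)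

lemma blockA_transpose (h : TimesDifferentiable 3 L) (z : Pt n m) :
    (blockA L z).transpose = blockA L z := by
  ext i j; exact (hessian_isSymm h z).apply _ _

lemma blockC_transpose (h : TimesDifferentiable 3 L) (z : Pt n m) :
    (blockC L z).transpose = blockC L z := by
  ext i j
  simpa [blockC, Matrix.toBlocks₂₂] using (hessian_isSymm h z).apply (Sum.inr i) (Sum.inr j)

lemma eq_sum_basisVec (v : Pt n m) : v = ∑ i, v i • basisVec i := by
  ext j
  simp [-Fintype.sum_sum_type, basisVec, Pi.single_apply]

lemma ofLp_fderiv_field (h : TimesDifferentiable 3 L) (z v : Pt n m) :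
    (fderiv ℝ (field L) z v).ofLp = (jacobian L z).mulVec v.ofLp := by
  have hsymm := hessian_isSymm h z
  have key : ∀ i, fderiv ℝ (fderiv ℝ L) z v (basisVec i) = (hessian L z).mulVec v.ofLp i := by
    intro i
    conv_lhs => rw [eq_sum_basisVec v]
    simp only [map_sum, map_smul, sum_apply, smul_apply,
      Matrix.mulVec, dotProduct, smul_eq_mul]
    refine Finset.sum_congr rfl fun j _ => ?_
    rw [mul_comm, ← hsymm.apply i j]
    rfl
  rw [(hasFDerivAt_field h z).fderiv]
  ext i
  rcases i with i | i
  · exact (key (Sum.inl i)).trans (by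
      simp [Matrix.mulVec, dotProduct, jacobian, blockA, blockB, Matrix.toBlocks₁₁,
        Matrix.toBlocks₁₂])
  · refine (congrArg Neg.neg (key (Sum.inr i))).trans ?_
    have : ∀ j, hessian L z (Sum.inr i) (Sum.inl j) = hessian L z (Sum.inl j) (Sum.inr i) :=
      fun j => hsymm.apply _ _
    simp [Matrix.mulVec, dotProduct, jacobian, blockB, blockC, Matrix.toBlocks₂₂,
        Matrix.toBlocks₁₂, this, add_comm]

/-- The off-diagonal blocks form a skew-symmetric matrix and do not contribute to the quadratic
form. -/
lemma dotProduct_fromBlocks_skew (M : Matrix (Fin n) (Fin n) ℝ) (N : Matrix (Fin m) (Fin m) ℝ)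
    (X : Matrix (Fin n) (Fin m) ℝ) (v : Pt n m) :
    v.ofLp ⬝ᵥ (Matrix.fromBlocks M X (-X.transpose) N).mulVec v.ofLp = blockQuad M N v := by
  have h0 : v.ofLp ⬝ᵥ (Matrix.fromBlocks 0 X (-X.transpose) 0).mulVec v.ofLp = 0 := by
    set S := Matrix.fromBlocks (0 : Matrix (Fin n) (Fin n) ℝ) X (-X.transpose)
      (0 : Matrix (Fin m) (Fin m) ℝ) with hS
    have hST : S.transpose = -S := by
      rw [hS, Matrix.fromBlocks_transpose, Matrix.fromBlocks_neg]; simp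
    have h1 : v.ofLp ⬝ᵥ S.mulVec v.ofLp = v.ofLp ⬝ᵥ S.transpose.mulVec v.ofLp := by
      rw [Matrix.mulVec_transpose, Matrix.dotProduct_mulVec, dotProduct_comm]
    rw [hST, Matrix.neg_mulVec, dotProduct_neg] at h1
    linarith
  have hsum : Matrix.fromBlocks M X (-X.transpose) N
      = Matrix.fromBlocks M 0 0 N + Matrix.fromBlocks 0 X (-X.transpose) 0 := by
    rw [Matrix.fromBlocks_add]; simp
  rw [hsum, Matrix.add_mulVec, dotProduct_add, h0, add_zero, blockQuad]

lemma inner_fderiv_field (h : TimesDifferentiable 3 L) (z v : Pt n m) :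
    ⟪v, fderiv ℝ (field L) z v⟫ = blockQuad (blockA L z) (blockC L z) v := by
  rw [← dotProduct_fromBlocks_skew _ _ (blockB L z), EuclideanSpace.inner_eq_star_dotProduct,
    ofLp_fderiv_field h, star_trivial, dotProduct_comm]
  rfl

/-- In the square of `[A, B; -Bᵀ, C]` the off-diagonal blocks are `AB + BC` and its negated
transpose, because `A` and `C` are symmetric. -/
lemma inner_fderiv_field_sq (h : TimesDifferentiable 3 L) (z v : Pt n m) :
    ⟪v, fderiv ℝ (field L) z (fderiv ℝ (field L) z v)⟫
      = blockQuad (blockA L z * blockA L z - blockB L z * (blockB L z).transpose)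
        (blockC L z * blockC L z - (blockB L z).transpose * blockB L z) v := by
  rw [← dotProduct_fromBlocks_skew _ _ (blockA L z * blockB L z + blockB L z * blockC L z),
    EuclideanSpace.inner_eq_star_dotProduct, ofLp_fderiv_field h, ofLp_fderiv_field h,
    star_trivial, dotProduct_comm, Matrix.mulVec_mulVec, jacobian, Matrix.fromBlocks_multiply]
  congr 3
  · simp [sub_eq_add_neg]
  · rw [Matrix.transpose_add, Matrix.transpose_mul, Matrix.transpose_mul, blockA_transpose h,
      blockC_transpose h]
    simp [add_comm]
  · simp [sub_eq_add_neg, add_comm]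

lemma blockQuad_add (M M' : Matrix (Fin n) (Fin n) ℝ) (N N' : Matrix (Fin m) (Fin m) ℝ)
    (v : Pt n m) : blockQuad (M + M') (N + N') v = blockQuad M N v + blockQuad M' N' v := by
  have : Matrix.fromBlocks (M + M') 0 0 (N + N')
      = Matrix.fromBlocks M 0 0 N + Matrix.fromBlocks M' 0 0 N' := by
    rw [Matrix.fromBlocks_add]; simp
  rw [blockQuad, this, Matrix.add_mulVec, dotProduct_add, blockQuad, blockQuad]

lemma blockQuad_smul (c : ℝ) (M : Matrix (Fin n) (Fin n) ℝ) (N : Matrix (Fin m) (Fin m) ℝ)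
    (v : Pt n m) : blockQuad (c • M) (c • N) v = c * blockQuad M N v := by
  have : Matrix.fromBlocks (c • M) 0 0 (c • N) = c • Matrix.fromBlocks M 0 0 N := by
    rw [Matrix.fromBlocks_smul]; simp
  rw [blockQuad, this, Matrix.smul_mulVec, dotProduct_smul, smul_eq_mul, blockQuad]

lemma OsConditionPPM.inner_le (h : TimesDifferentiable 3 L) {s r : ℝ} (hc : OsConditionPPM L s r)
    (z : Pt n m) : r / 2 * ‖field L z‖ ^ 2 ≤
      ⟪field L z, fderiv ℝ (field L) z (field L z)⟫
      - 1 * (s / 2) * ⟪field L z, fderiv ℝ (field L) z (fderiv ℝ (field L) z (field L z))⟫ := by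
  refine (hc z).trans_eq ?_
  rw [inner_fderiv_field h, inner_fderiv_field_sq h, sub_eq_add_neg (blockQuad _ _ _),
    ← neg_mul, ← blockQuad_smul, ← blockQuad_add]
  congr 1 <;> module

lemma OsConditionGDA.inner_le (h : TimesDifferentiable 3 L) {s r : ℝ} (hc : OsConditionGDA L s r)
    (z : Pt n m) : r / 2 * ‖field L z‖ ^ 2 ≤
      ⟪field L z, fderiv ℝ (field L) z (field L z)⟫
      - (-1) * (s / 2) *
        ⟪field L z, fderiv ℝ (field L) z (fderiv ℝ (field L) z (field L z))⟫ := by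
  refine (hc z).trans_eq ?_
  rw [inner_fderiv_field h, inner_fderiv_field_sq h, sub_eq_add_neg (blockQuad _ _ _),
    ← neg_mul, ← blockQuad_smul, ← blockQuad_add]
  congr 1 <;> module

lemma O1ConditionJM.inner_le (h : TimesDifferentiable 3 L) {r : ℝ} (hc : O1ConditionJM L r)
    (z : Pt n m) : r / 2 * ‖field L z‖ ^ 2 ≤
      -⟪field L z, fderiv ℝ (field L) z (fderiv ℝ (field L) z (field L z))⟫ := by
  refine (hc z).trans_eq ?_
  rw [inner_fderiv_field_sq h, neg_eq_neg_one_mul, ← blockQuad_smul]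
  congr 1 <;> module

end SaddleField

/-! ### Convergence of the methods -/

section Algorithms
variable {n m : ℕ} {L : Pt n m → ℝ} {z0 : Pt n m} {step : Update n m}

lemma BoundedOnHull.exists_bounds {k : ℕ} (h : BoundedOnHull L step z0 k) (hk : 2 ≤ k) :
    ∃ s1 : ℝ, 0 < s1 ∧ ∃ M M2 : ℝ, ∀ z ∈ levelHull L step z0 s1,
      ‖fderiv ℝ (field L) z‖ ≤ M ∧ ‖fderiv ℝ (fderiv ℝ (field L)) z‖ ≤ M2 := by
  obtain ⟨s1, hs1, h⟩ := h
  obtain ⟨M, hM⟩ := h 1 le_rfl (by omega)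
  obtain ⟨M2, hM2⟩ := h 2 (by norm_num) hk
  refine ⟨s1, hs1, M, M2, fun z hz => ⟨?_, ?_⟩⟩
  · rw [← norm_iteratedFDeriv_one]; exact hM z hz
  · rw [← norm_iteratedFDeriv_one, norm_iteratedFDeriv_fderiv]; exact hM2 z hz

lemma mem_levelHull_of_step_zero {s : ℝ} (hs : 0 ≤ s) (hstep : ∀ z, step 0 z z) {z : Pt n m}
    (hz : ‖field L z‖ ≤ ‖field L z0‖) : z ∈ levelHull L step z0 s :=
  subset_convexHull ℝ _ ⟨z, 0, hz, le_rfl, hs, hstep z⟩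

lemma linearForSmallSteps_of_eventually {ρ : ℝ → ℝ}
    (h : ∀ᶠ s in 𝓝[>] (0 : ℝ),
      (∃ u : ℕ → Pt n m, u 0 = z0 ∧ ∀ k, step s (u k) (u (k + 1))) ∧
      ∀ u : ℕ → Pt n m, u 0 = z0 → (∀ k, step s (u k) (u (k + 1))) →
        (∀ k, ‖field L (u k)‖ ^ 2 ≤ (1 - s * ρ s / 4) ^ k * ‖field L z0‖ ^ 2) ∧
        ∃ zs, field L zs = 0 ∧
          ∃ θ C : ℝ, 0 < θ ∧ θ < 1 ∧ ∀ k : ℕ, ‖u k - zs‖ ≤ C * θ ^ k) :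
    LinearForSmallSteps L step z0 ρ := by
  obtain ⟨s', hs', hsub⟩ := mem_nhdsGT_iff_exists_Ioc_subset.1 h
  refine ⟨s', hs', fun s hs hle => ?_⟩
  obtain ⟨hex, hall⟩ := hsub ⟨hs, hle⟩
  refine ⟨hex, fun u hu => ?_⟩
  obtain ⟨hE, hz⟩ := hall u hu.1 hu.2
  refine ⟨fun k => ?_, hz⟩
  have := hE k
  rw [energy, energy, hu.1]
  linarith

/-- Every point of the sublevel set has an output of `step` for small step-sizes, and all outputs
agree with `z - s F + (1 + σ) / 2 s² DF F` up to `o(s²)`, wherever `F` is nearly affine. The value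
`σ = -1` is that of gradient descent ascent, `σ = 1` that of the extra-gradient and proximal point
methods. -/
structure IsSecondOrder (L : Pt n m → ℝ) (step : Update n m) (z0 : Pt n m) (M σ : ℝ) : Prop where
  exists_step : ∀ᶠ s in 𝓝[>] (0 : ℝ), ∀ z, ‖field L z‖ ≤ ‖field L z0‖ → ∃ w, step s z w
  approx : ∀ ε : ℝ, 0 < ε → ∀ᶠ s in 𝓝[>] (0 : ℝ), ∀ z w, ‖field L z‖ ≤ ‖field L z0‖ →
    NearlyAffine (field L) z (2 * s * ‖field L z‖) M ε → step s z w →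
    ‖w - z‖ ≤ 2 * s * ‖field L z‖ ∧
    ‖w - (z - s • field L z
        + ((1 + σ) / 2 * s ^ 2) • fderiv ℝ (field L) z (field L z))‖
      ≤ 4 * s ^ 2 * ε * ‖field L z‖

lemma isSecondOrder_gda (L : Pt n m → ℝ) (z0 : Pt n m) (M : ℝ) :
    IsSecondOrder L (gda L) z0 M (-1) where
  exists_step := Eventually.of_forall fun _ _ _ => ⟨_, rfl⟩
  approx ε hε := by
    filter_upwards [self_mem_nhdsWithin] with s hs z w _ _ hw
    exact NearlyAffine.gda_approx (le_of_lt hs) hε.le hw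

lemma isSecondOrder_egm (L : Pt n m → ℝ) (z0 : Pt n m) (M : ℝ) :
    IsSecondOrder L (egm L) z0 M 1 where
  exists_step := Eventually.of_forall fun _ _ _ => ⟨_, rfl⟩
  approx ε hε := by
    filter_upwards [self_mem_nhdsWithin, eventually_mul_le (8 * (M + 1) ^ 2) hε]
      with s hs hsM z w _ haff hw
    exact haff.egm_approx (le_of_lt hs) hε.le (by linarith) hw

/-- Outputs of the proximal point update belong to the hull by its definition, so the segment from
`z` to `w` does too, and the derivative bound there controls an arbitrary solution `w`. -/
lemma norm_ppm_le (hF : Differentiable ℝ (field L)) {s1 M t : ℝ} {z w : Pt n m}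
    (hM : ∀ z ∈ levelHull L (ppm L) z0 s1, ‖fderiv ℝ (field L) z‖ ≤ M)
    (hz : ‖field L z‖ ≤ ‖field L z0‖) (ht0 : 0 ≤ t) (ht1 : t ≤ s1) (htM : t * M ≤ 1 / 2)
    (hw : ppm L t z w) :
    ‖fderiv ℝ (field L) w‖ ≤ M ∧ ‖field L w‖ ≤ 2 * ‖field L z‖ ∧
      ‖w - z‖ ≤ 2 * t * ‖field L z‖ := by
  have hzS : z ∈ levelHull L (ppm L) z0 s1 :=
    mem_levelHull_of_step_zero (ht0.trans ht1) (fun z => by simp [ppm]) hz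
  have hwS : w ∈ levelHull L (ppm L) z0 s1 := subset_convexHull ℝ _ ⟨z, t, hz, ht0, ht1, hw⟩
  have h1 := (convex_convexHull ℝ _).norm_image_sub_le_of_norm_hasFDerivWithin_le
    (fun x _ => (hF x).hasFDerivAt.hasFDerivWithinAt) hM hzS hwS
  have hwz : ‖w - z‖ = t * ‖field L w‖ := by
    have : w - z = -(t • field L w) := by rw [sub_eq_iff_eq_add, neg_add_eq_sub]; exact hw
    rw [this, norm_neg, norm_smul, Real.norm_of_nonneg ht0]
  rw [hwz] at h1 ⊢
  have h2 := norm_le_norm_add_norm_sub' (field L w) (field L z)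
  have h3 := mul_le_mul_of_nonneg_right htM (norm_nonneg (field L w))
  have h4 : ‖field L w‖ ≤ 2 * ‖field L z‖ := by linarith
  refine ⟨hM w hwS, h4, ?_⟩
  have := mul_le_mul_of_nonneg_left h4 ht0
  linarith

lemma isSecondOrder_ppm (hL : TimesDifferentiable 3 L) {s1 M : ℝ} (hs1 : 0 < s1)
    (hM : ∀ z ∈ levelHull L (ppm L) z0 s1, ‖fderiv ℝ (field L) z‖ ≤ M) :
    IsSecondOrder L (ppm L) z0 M 1 := by
  have hM0 : 0 ≤ M := (norm_nonneg _).trans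
    (hM z0 (mem_levelHull_of_step_zero hs1.le (fun z => by simp [ppm]) le_rfl))
  have hF := differentiable_field hL
  have hF1 : ContDiff ℝ 1 (field L) :=
    contDiff_one_iff_fderiv.2 ⟨hF, (differentiable_fderiv_field hL).continuous⟩
  constructor
  · filter_upwards [self_mem_nhdsWithin, eventually_mul_le 1 hs1,
      eventually_mul_le M one_half_pos] with s hs hs1 hsM z hz
    have hs : 0 < s := hs
    refine exists_proximal_point hF1 hs.le hsM fun t ht w hw => ?_
    have := norm_ppm_le hF hM hz ht.1 (ht.2.trans (by linarith))
      ((mul_le_mul_of_nonneg_right ht.2 hM0).trans hsM) hw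
    exact ⟨this.1, this.2.1⟩
  · intro ε hε
    filter_upwards [self_mem_nhdsWithin, eventually_mul_le 1 hs1,
      eventually_mul_le M one_half_pos, eventually_mul_le (8 * (M + 1) ^ 2) hε]
      with s hs hs1 hsM hsε z w hz haff hw
    have hs : 0 < s := hs
    have hwz := (norm_ppm_le hF hM hz hs.le (by linarith) hsM hw).2.2
    exact ⟨hwz, haff.ppm_approx hs.le hε.le (by linarith) hw hwz⟩

lemma inner_apply_apply_le {E : Type*} [NormedAddCommGroup E] [InnerProductSpace ℝ E]
    {J : E →L[ℝ] E} {K : ℝ} (hJ : ‖J‖ ≤ K) (v : E) : |⟪v, J (J v)⟫| ≤ K ^ 2 * ‖v‖ ^ 2 := by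
  have hK : 0 ≤ K := (norm_nonneg _).trans hJ
  have h1 : ‖J v‖ ≤ K * ‖v‖ := J.le_of_opNorm_le hJ v
  have h2 : ‖J (J v)‖ ≤ K * (K * ‖v‖) :=
    (J.le_of_opNorm_le hJ _).trans (mul_le_mul_of_nonneg_left h1 hK)
  calc _ ≤ ‖v‖ * ‖J (J v)‖ := abs_real_inner_le_norm _ _
    _ ≤ ‖v‖ * (K * (K * ‖v‖)) := mul_le_mul_of_nonneg_left h2 (norm_nonneg _)
    _ = _ := by ring

/-- Convergence under the second-order condition. The choice of `ε` makes the error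
`36 (M + 1) ε s²` of `NearlyAffine.normSq_step_le` at most `d s² / 4 ≤ s ρ(s) / 4`, which leaves
half of the decay `s ρ(s) / 2`. -/
lemma IsSecondOrder.linearForSmallSteps (hL : TimesDifferentiable 3 L) {M M2 σ : ℝ}
    (hM : ∀ z, ‖field L z‖ ≤ ‖field L z0‖ → ‖fderiv ℝ (field L) z‖ ≤ M)
    (hM2 : ∀ z, ‖field L z‖ ≤ ‖field L z0‖ → ‖fderiv ℝ (fderiv ℝ (field L)) z‖ ≤ M2)
    (h : IsSecondOrder L step z0 M σ) (hσ : |σ| ≤ 1) {ρ : ℝ → ℝ} {d s0 : ℝ} (hd : 0 < d)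
    (hs0 : 0 < s0) (hρ : ∀ s, 0 < s → s ≤ s0 → d * s ≤ ρ s)
    (hcond : ∀ s, 0 < s → s ≤ s0 → ∀ z, ρ s / 2 * ‖field L z‖ ^ 2 ≤
      ⟪field L z, fderiv ℝ (field L) z (field L z)⟫
      - σ * (s / 2) * ⟪field L z, fderiv ℝ (field L) z (fderiv ℝ (field L) z (field L z))⟫) :
    LinearForSmallSteps L step z0 ρ := by
  have hM0 : 0 ≤ M := (norm_nonneg _).trans (hM z0 le_rfl)
  have hε : 0 < min 1 (d / (144 * (M + 1))) := by positivity
  have hεd : 36 * (M + 1) * min 1 (d / (144 * (M + 1))) ≤ d / 4 := by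
    calc _ ≤ 36 * (M + 1) * (d / (144 * (M + 1))) := by gcongr; exact min_le_right _ _
      _ = d / 4 := by field_simp; norm_num
  set ε := min 1 (d / (144 * (M + 1))) with hεdef
  refine linearForSmallSteps_of_eventually (eventually_run_converges (differentiable_field hL)
    (differentiable_fderiv_field hL) hM hM2 hε (min_le_left _ _) hd zero_le_two ?_ ?_
    h.exists_step ?_)
  · filter_upwards [self_mem_nhdsWithin, eventually_mul_le 1 hs0] with s hs hs0
    exact hρ s hs (by linarith)
  · -- At `z0`, where `F` does not vanish, the condition itself bounds `ρ s` from above.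
    intro hz0
    filter_upwards [self_mem_nhdsWithin, eventually_mul_le 1 hs0, eventually_mul_le 1 one_pos,
      eventually_mul_le (2 * M + M ^ 2) four_pos] with s hs hs0 hs1 hsM
    have hs : 0 < s := hs
    have hN : 0 < ‖field L z0‖ ^ 2 := by have := norm_pos_iff.2 hz0; positivity
    have h1 := hcond s hs (by linarith) z0
    have h2 : ⟪field L z0, fderiv ℝ (field L) z0 (field L z0)⟫ ≤ M * ‖field L z0‖ ^ 2 := by
      have := (real_inner_le_norm (field L z0) _).trans (mul_le_mul_of_nonneg_left
        ((fderiv ℝ (field L) z0).le_of_opNorm_le (hM z0 le_rfl) (field L z0)) (norm_nonneg _))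
      linarith
    obtain ⟨hσ1, hσ2⟩ := abs_le.1 hσ
    have h4 := inner_apply_apply_le (hM z0 le_rfl) (field L z0)
    have h5 : -(σ * (s / 2) * ⟪field L z0,
        fderiv ℝ (field L) z0 (fderiv ℝ (field L) z0 (field L z0))⟫)
        ≤ s / 2 * (M ^ 2 * ‖field L z0‖ ^ 2) := by
      refine (neg_le_abs _).trans ?_
      rw [abs_mul, abs_mul, abs_of_nonneg (by linarith : 0 ≤ s / 2)]
      refine mul_le_mul ?_ h4 (abs_nonneg _) (by linarith)
      nlinarith
    have h6 : ρ s ≤ 2 * M + s * M ^ 2 := by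
      refine le_of_mul_le_mul_right ?_ hN
      linarith
    have h7 : s * ρ s ≤ s * (2 * M + s * M ^ 2) := mul_le_mul_of_nonneg_left h6 hs.le
    have h8 : s * (s * M ^ 2) ≤ s * (1 * M ^ 2) :=
      mul_le_mul_of_nonneg_left (mul_le_mul_of_nonneg_right (by linarith) (sq_nonneg _)) hs.le
    linarith
  · filter_upwards [self_mem_nhdsWithin, eventually_mul_le 1 hs0, h.approx ε hε,
      eventually_mul_le (8 * (M + 1) ^ 2) hε] with s hs hs0 happ hsM z w hz haff hw
    have hs : 0 < s := hs
    have hs0' : s ≤ s0 := by linarith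
    obtain ⟨h1, h2⟩ := happ z w hz haff hw
    have hρs := hρ s hs hs0'
    have hρ0 : 0 ≤ ρ s := le_trans (by positivity) hρs
    refine ⟨h1, (haff.normSq_step_le hs.le (by linarith) hσ hρ0 (fun p _ => hcond s hs hs0' p)
      (mem_closedBall_iff_norm.2 h1) h2).trans
        (mul_le_mul_of_nonneg_right ?_ (sq_nonneg _))⟩
    have h3 := mul_le_mul_of_nonneg_right hεd (sq_nonneg s)
    have h4 := mul_le_mul_of_nonneg_left hρs hs.le
    linarith

/-- The first-order condition implies the second-order one with `ρ` replaced by `ρ - s (M + 1)²`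
on balls where `‖DF‖ ≤ M + 1`; the loss is of order `s²` in the decay, against a gain of order
`s`. -/
lemma IsSecondOrder.linearForSmallSteps_const (hL : TimesDifferentiable 3 L) {M M2 σ : ℝ}
    (hM : ∀ z, ‖field L z‖ ≤ ‖field L z0‖ → ‖fderiv ℝ (field L) z‖ ≤ M)
    (hM2 : ∀ z, ‖field L z‖ ≤ ‖field L z0‖ → ‖fderiv ℝ (fderiv ℝ (field L)) z‖ ≤ M2)
    (h : IsSecondOrder L step z0 M σ) (hσ : |σ| ≤ 1) {ρ : ℝ} (hρ : 0 < ρ)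
    (hcond : O1Condition L ρ) : LinearForSmallSteps L step z0 fun _ => ρ := by
  have hM0 : 0 ≤ M := (norm_nonneg _).trans (hM z0 le_rfl)
  refine linearForSmallSteps_of_eventually (eventually_run_converges (differentiable_field hL)
    (differentiable_fderiv_field hL) hM hM2 one_pos le_rfl hρ zero_le_two ?_
    (fun _ => eventually_mul_le ρ four_pos) h.exists_step ?_)
  · filter_upwards [eventually_mul_le 1 one_pos] with s hs
    exact mul_le_of_le_one_right hρ.le (by linarith)
  · filter_upwards [self_mem_nhdsWithin, h.approx 1 one_pos,
      eventually_mul_le (8 * (M + 1) ^ 2) one_pos, eventually_mul_le ((M + 1) ^ 2) hρ,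
      eventually_mul_le ((M + 1) ^ 2 / 2 + 36 * (M + 1)) (by positivity : 0 < ρ / 4)]
      with s hs happ hsM hsρ hs4 z w hz haff hw
    have hs : 0 < s := hs
    obtain ⟨h1, h2⟩ := happ z w hz haff hw
    refine ⟨h1, (haff.normSq_step_le hs.le (by linarith) hσ (ρ := ρ - s * (M + 1) ^ 2)
      (by linarith) (fun p hp => ?_)
      (mem_closedBall_iff_norm.2 h1) h2).trans
        (mul_le_mul_of_nonneg_right ?_ (sq_nonneg _))⟩
    · have h3 := hcond p
      rw [← inner_fderiv_field hL] at h3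
      have h4 := inner_apply_apply_le (haff.norm_fderiv_le_add_one hp) (field L p)
      have h5 : σ * (s / 2) * ⟪field L p,
          fderiv ℝ (field L) p (fderiv ℝ (field L) p (field L p))⟫
          ≤ s / 2 * ((M + 1) ^ 2 * ‖field L p‖ ^ 2) := by
        refine (le_abs_self _).trans ?_
        rw [abs_mul, abs_mul, abs_of_nonneg (by linarith : 0 ≤ s / 2)]
        exact mul_le_mul (mul_le_of_le_one_left (by linarith) hσ) h4 (abs_nonneg _)
          (by linarith)
      linarith
    · have := mul_le_mul_of_nonneg_left hs4 hs.le
      linarith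

lemma linearForSmallSteps_jm (hL : TimesDifferentiable 3 L) {M M2 : ℝ}
    (hM : ∀ z, ‖field L z‖ ≤ ‖field L z0‖ → ‖fderiv ℝ (field L) z‖ ≤ M)
    (hM2 : ∀ z, ‖field L z‖ ≤ ‖field L z0‖ → ‖fderiv ℝ (fderiv ℝ (field L)) z‖ ≤ M2)
    {ρ : ℝ} (hρ : 0 < ρ) (hcond : O1ConditionJM L ρ) :
    LinearForSmallSteps L (jm L) z0 fun _ => ρ := by
  have hM0 : 0 ≤ M := (norm_nonneg _).trans (hM z0 le_rfl)
  have hε : 0 < min 1 (ρ / (32 * (M + 1))) := by positivity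
  have hερ : 8 * (M + 1) * min 1 (ρ / (32 * (M + 1))) ≤ ρ / 4 := by
    calc _ ≤ 8 * (M + 1) * (ρ / (32 * (M + 1))) := by gcongr; exact min_le_right _ _
      _ = ρ / 4 := by field_simp; norm_num
  set ε := min 1 (ρ / (32 * (M + 1))) with hεdef
  refine linearForSmallSteps_of_eventually (eventually_run_converges (differentiable_field hL)
    (differentiable_fderiv_field hL) hM hM2 hε (min_le_left _ _) hρ
    (by linarith : 0 ≤ M + 1) ?_ (fun _ => eventually_mul_le ρ four_pos)
    (Eventually.of_forall fun _ _ _ => ⟨_, rfl⟩) ?_)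
  · filter_upwards [eventually_mul_le 1 one_pos] with s hs
    exact mul_le_of_le_one_right hρ.le (by linarith)
  · filter_upwards [self_mem_nhdsWithin, eventually_mul_le (4 * (M + 1) ^ 3) hε]
      with s hs hsM z w hz haff hw
    have hs : 0 < s := hs
    obtain ⟨h1, h2⟩ := haff.normSq_jm_le hs.le (by linarith) hρ.le
      (fun p => hcond.inner_le hL p) hw
    refine ⟨h1, h2.trans (mul_le_mul_of_nonneg_right ?_ (sq_nonneg _))⟩
    have := mul_le_mul_of_nonneg_left hερ hs.le
    linarith

lemma BoundedOnHull.exists_sublevel_bounds {k : ℕ} (h : BoundedOnHull L step z0 k) (hk : 2 ≤ k)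
    (hstep : ∀ z, step 0 z z) : ∃ M M2 : ℝ,
      (∀ z, ‖field L z‖ ≤ ‖field L z0‖ → ‖fderiv ℝ (field L) z‖ ≤ M) ∧
      ∀ z, ‖field L z‖ ≤ ‖field L z0‖ → ‖fderiv ℝ (fderiv ℝ (field L)) z‖ ≤ M2 := by
  obtain ⟨s1, hs1, M, M2, hb⟩ := h.exists_bounds hk
  exact ⟨M, M2, fun z hz => (hb z (mem_levelHull_of_step_zero hs1.le hstep hz)).1,
    fun z hz => (hb z (mem_levelHull_of_step_zero hs1.le hstep hz)).2⟩

end Algorithms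

end Minimax

theorem mainTheorem7 (n m : ℕ) (L : Minimax.Pt n m → ℝ) (z0 : Minimax.Pt n m) :
    -- (i) GDA, PPM and EGM under the O(1) condition
    (Minimax.TimesDifferentiable 3 L →
      ∀ ρ : ℝ, 0 < ρ → Minimax.O1Condition L ρ →
        (Minimax.BoundedOnHull L (Minimax.gda L) z0 2 →
          Minimax.LinearForSmallSteps L (Minimax.gda L) z0 (fun _ => ρ)) ∧
        (Minimax.BoundedOnHull L (Minimax.ppm L) z0 2 →
          Minimax.LinearForSmallSteps L (Minimax.ppm L) z0 (fun _ => ρ)) ∧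
        (Minimax.BoundedOnHull L (Minimax.egm L) z0 2 →
          Minimax.LinearForSmallSteps L (Minimax.egm L) z0 (fun _ => ρ))) ∧
    -- (ii) PPM and EGM under their O(s) condition
    (Minimax.TimesDifferentiable 5 L →
      ∀ (ρ : ℝ → ℝ) (d s0 : ℝ), 0 < d → 0 < s0 →
        (∀ s : ℝ, 0 < s → s ≤ s0 → d * s ≤ ρ s ∧ Minimax.OsConditionPPM L s (ρ s)) →
        (Minimax.BoundedOnHull L (Minimax.ppm L) z0 4 →
          Minimax.LinearForSmallSteps L (Minimax.ppm L) z0 ρ) ∧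
        (Minimax.BoundedOnHull L (Minimax.egm L) z0 4 →
          Minimax.LinearForSmallSteps L (Minimax.egm L) z0 ρ)) ∧
    -- (iii) GDA under its O(s) condition
    (Minimax.TimesDifferentiable 5 L →
      ∀ (ρ : ℝ → ℝ) (d s0 : ℝ), 0 < d → 0 < s0 →
        (∀ s : ℝ, 0 < s → s ≤ s0 → d * s ≤ ρ s ∧ Minimax.OsConditionGDA L s (ρ s)) →
        Minimax.BoundedOnHull L (Minimax.gda L) z0 4 →
          Minimax.LinearForSmallSteps L (Minimax.gda L) z0 ρ) ∧
    -- (iv) JM under its O(1) condition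
    (Minimax.TimesDifferentiable 4 L →
      ∀ ρ : ℝ, 0 < ρ → Minimax.O1ConditionJM L ρ →
        Minimax.BoundedOnHull L (Minimax.jm L) z0 3 →
          Minimax.LinearForSmallSteps L (Minimax.jm L) z0 (fun _ => ρ)) := by
  have gda0 : ∀ z, Minimax.gda L 0 z z := fun z => by simp [Minimax.gda]
  have egm0 : ∀ z, Minimax.egm L 0 z z := fun z => by simp [Minimax.egm]
  have jm0 : ∀ z, Minimax.jm L 0 z z := fun z => by simp [Minimax.jm]
  have ppm0 : ∀ z, Minimax.ppm L 0 z z := fun z => by simp [Minimax.ppm]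
  have hσ1 : |(1 : ℝ)| ≤ 1 := by norm_num
  have hσ2 : |(-1 : ℝ)| ≤ 1 := by norm_num
  refine ⟨fun hL ρ hρ hc => ⟨fun hb => ?_, fun hb => ?_, fun hb => ?_⟩,
    fun hL ρ d s0 hd hs0 hc => ⟨fun hb => ?_, fun hb => ?_⟩,
    fun hL ρ d s0 hd hs0 hc hb => ?_, fun hL ρ hρ hc hb => ?_⟩
  · obtain ⟨M, M2, hM, hM2⟩ := hb.exists_sublevel_bounds le_rfl gda0
    exact (Minimax.isSecondOrder_gda L z0 M).linearForSmallSteps_const hL hM hM2 hσ2 hρ hc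
  · obtain ⟨s1, hs1, M, M2, hM⟩ := hb.exists_bounds le_rfl
    exact (Minimax.isSecondOrder_ppm hL hs1 fun z hz => (hM z hz).1).linearForSmallSteps_const hL
      (fun z hz => (hM z (Minimax.mem_levelHull_of_step_zero hs1.le ppm0 hz)).1)
      (fun z hz => (hM z (Minimax.mem_levelHull_of_step_zero hs1.le ppm0 hz)).2) hσ1 hρ hc
  · obtain ⟨M, M2, hM, hM2⟩ := hb.exists_sublevel_bounds le_rfl egm0
    exact (Minimax.isSecondOrder_egm L z0 M).linearForSmallSteps_const hL hM hM2 hσ1 hρ hc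
  · obtain ⟨s1, hs1, M, M2, hM⟩ := hb.exists_bounds (by norm_num)
    have hL := hL.mono (show 3 ≤ 5 by norm_num)
    exact (Minimax.isSecondOrder_ppm hL hs1 fun z hz => (hM z hz).1).linearForSmallSteps hL
      (fun z hz => (hM z (Minimax.mem_levelHull_of_step_zero hs1.le ppm0 hz)).1)
      (fun z hz => (hM z (Minimax.mem_levelHull_of_step_zero hs1.le ppm0 hz)).2) hσ1 hd hs0
      (fun s hs hle => (hc s hs hle).1) (fun s hs hle => (hc s hs hle).2.inner_le hL)
  · obtain ⟨M, M2, hM, hM2⟩ := hb.exists_sublevel_bounds (by norm_num) egm0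
    have hL := hL.mono (show 3 ≤ 5 by norm_num)
    exact (Minimax.isSecondOrder_egm L z0 M).linearForSmallSteps hL hM hM2 hσ1 hd hs0
      (fun s hs hle => (hc s hs hle).1) (fun s hs hle => (hc s hs hle).2.inner_le hL)
  · obtain ⟨M, M2, hM, hM2⟩ := hb.exists_sublevel_bounds (by norm_num) gda0
    have hL := hL.mono (show 3 ≤ 5 by norm_num)
    exact (Minimax.isSecondOrder_gda L z0 M).linearForSmallSteps hL hM hM2 hσ2 hd hs0
      (fun s hs hle => (hc s hs hle).1) (fun s hs hle => (hc s hs hle).2.inner_le hL)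
  · obtain ⟨M, M2, hM, hM2⟩ := hb.exists_sublevel_bounds (by norm_num) jm0
    exact Minimax.linearForSmallSteps_jm (hL.mono (by norm_num)) hM hM2 hρ hc
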